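/- Let $n\ge 3$ and let $s$ be an integer with $s\ge [n/2]+1$. Let $\mu>0$, $\frac{2}{n}\mu+\mu'\ge 0$, $\kappa>0$, put $\nu=\mu$, $\tilde\nu=\mu+\mu'$, and let $r_1>0$. Write $\hat f(\xi)=\int_{\mathbb{R}^n} f(x)e^{-ix\cdot\xi}\,dx$ and let $H^k_{(\infty)}$ be the space of all (complex-valued) $f\in H^k(\mathbb{R}^n)$ with $\operatorname{supp}\hat f\subset\{|\xi|\ge r_1\}$, with the norm $\|f\|_{H^k}=\big(\sum_{|\alpha|\le k}\|\partial^\alpha f\|_{L^2}^2\big)^{1/2}$. Let $X=H^s_{(\infty)}\times (H^{s-1}_{(\infty)})^n$, with elements $u={}^\top(\phi,m)$ and norm $\|u\|_X=(\|\phi\|_{H^s}^2+\|m\|_{H^{s-1}}^2)^{1/2}$. Consider the linearized Navier–Stokes–Korteweg system $\partial_t u+Au=0$ with $$A\begin{pmatrix}\phi\\ m\end{pmatrix}=\begin{pmatrix}\operatorname{div} m\\ -\kappa\nabla\Delta\phi-\nu\Delta m-\tilde\nu\nabla\operatorname{div} m\end{pmatrix}$$ (derivatives in the sense of distributions). Its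 solution operator $S_\infty(t)$, $t\ge0$, is the Fourier multiplier with matrix $$\begin{pmatrix} \dfrac{\lambda_+e^{\lambda_-t}-\lambda_-e^{\lambda_+t}}{\lambda_+-\lambda_-} & -i\,\dfrac{e^{\lambda_+t}-e^{\lambda_-t}}{\lambda_+-\lambda_-}\,{}^\top\xi\\[2ex] -i\kappa|\xi|^2\,\dfrac{e^{\lambda_+t}-e^{\lambda_-t}}{\lambda_+-\lambda_-}\,\xi & e^{-\nu|\xi|^2t}I_n+\Big(\dfrac{\lambda_+e^{\lambda_+t}-\lambda_-e^{\lambda_-t}}{\lambda_+-\lambda_-}-e^{-\nu|\xi|^2t}\Big)\dfrac{\xi\,{}^\top\xi}{|\xi|^2}\end{pmatrix},$$ $$\lambda_\pm(\xi)=-\tfrac{\nu+\tilde\nu}{2}\big(|\xi|^2\pm|\xi|^2\sqrt{1-K^2}\big),\qquad K=\tfrac{2\sqrt\kappa}{\nu+\tilde\nu},$$ where the quotients are replaced by their limits when $\lambda_+=\lambda_-$. Then $\{S_\infty(t)\}_{t\ge0}$ is a well-defined family of bounded linear operators on $X$ and: 1. $\{S_\infty(t)\}_{t\ge 0}$ is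 a $C^0$-semigroup on $X$. 2. Its infinitesimal generator is $-A$, with domain $\{u\in X: Au\in X\}$. 3. For every $T>0$ and every $u_0\in C([0,T];X)$ (in particular for every constant $u_0\in X$) the function $t\mapsto S_\infty(t)u_0(t)$ belongs to $C([0,T];X)$. 4. There is a constant $C>0$, independent of $t$, such that $\|S_\infty(t)u_0\|_{X}\le C\|u_0\|_{X}$ for all $t\ge0$ and all $u_0\in X$. -/

import Mathlib

open MeasureTheory Filter Topology
open scoped FourierTransform SchwartzMap LineDeriv Laplacian NNReal ENNReal

noncomputable section

namespace NSK

/-- The space `ℝⁿ` with its Euclidean norm. -/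
abbrev Sp (n : ℕ) : Type := EuclideanSpace ℝ (Fin n)

/-- The complex Hilbert space `L²(ℝⁿ)`. -/
abbrev L2 (n : ℕ) : Type := Lp ℂ 2 (volume : Measure (Sp n))

/-- The `j`-th standard basis vector of `ℝⁿ`. -/
abbrev e {n : ℕ} (j : Fin n) : Sp n := EuclideanSpace.single j 1

/-- An `L²` function as a tempered distribution. -/
abbrev toDistr {n : ℕ} (f : L2 n) : 𝓢'(Sp n, ℂ) := Lp.toTemperedDistribution f

/-- The differential operator `∂^α = ∂₁^{α₁} ⋯ ∂ₙ^{αₙ}` on tempered distributions. -/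
def multiDeriv {n : ℕ} (α : Fin n → ℕ) : 𝓢'(Sp n, ℂ) →L[ℂ] 𝓢'(Sp n, ℂ) :=
  ((List.finRange n).map fun j =>
    (LineDeriv.lineDerivOpCLM ℂ 𝓢'(Sp n, ℂ) (e j : Sp n)) ^ α j).prod

/-- The multi-indices `α ∈ ℕⁿ` with `|α| ≤ k`. (Each entry is then at most `k`.) -/
abbrev MultiIndex (n k : ℕ) : Type := {α : Fin n → Fin (k + 1) // ∑ i, (α i : ℕ) ≤ k}

/-- The multi-index `0`. -/
def MultiIndex.zero (n k : ℕ) : MultiIndex n k := ⟨fun _ => 0, by simp⟩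

/-- The Sobolev space `H^k(ℝⁿ)` with the norm `‖f‖² = ∑_{|α| ≤ k} ‖∂^α f‖²_{L²}`. A function
`f ∈ H^k` is recorded as the family `(∂^α f)_{|α| ≤ k}` of its weak derivatives, all of which are
required to be in `L²`; the function itself is the entry at the multi-index `0`. -/
def H (n k : ℕ) : Submodule ℂ (PiLp 2 fun _ : MultiIndex n k => L2 n) where
  carrier := {F | ∀ α : MultiIndex n k,
    toDistr (F α) = multiDeriv (fun i => (α.1 i : ℕ)) (toDistr (F (MultiIndex.zero n k)))}
  zero_mem' := by
    intro α
    have h : toDistr (0 : L2 n) = 0 := map_zero (Lp.toTemperedDistributionCLM ℂ volume 2)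
    simp [h]
  add_mem' := by
    intro F G hF hG α
    have h : ∀ f g : L2 n, toDistr (f + g) = toDistr f + toDistr g := fun f g =>
      map_add (Lp.toTemperedDistributionCLM ℂ volume 2) f g
    simp only [PiLp.add_apply, h, map_add, hF α, hG α]
  smul_mem' := by
    intro c F hF α
    have h : ∀ f : L2 n, toDistr (c • f) = c • toDistr f := fun f =>
      map_smul (Lp.toTemperedDistributionCLM ℂ volume 2) c f
    simp only [PiLp.smul_apply, h, map_smul, hF α]

/-- The functions of `L²` whose Fourier transform `∫ f(x) e^{-i x·ξ} dx` is supported in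
`{|ξ| ≥ r}`. Mathlib's `𝓕 f η` is the integral `∫ f(x) e^{-2πi x·η} dx`, so that `ξ = 2πη`. -/
def L2High (n : ℕ) (r : ℝ) : Submodule ℂ (L2 n) where
  carrier := {f | ∀ᵐ η : Sp n, ‖(2 * Real.pi) • η‖ < r → (𝓕 f : L2 n) η = 0}
  zero_mem' := by
    have h : (𝓕 (0 : L2 n) : L2 n) = 0 := map_zero (Lp.fourierTransformₗᵢ (Sp n) ℂ)
    simp only [Set.mem_ofPred_eq, h]
    filter_upwards [Lp.coeFn_zero ℂ 2 (volume : Measure (Sp n))] with η hη _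
    exact hη
  add_mem' := by
    intro f g hf hg
    have h : (𝓕 (f + g) : L2 n) = 𝓕 f + 𝓕 g := map_add (Lp.fourierTransformₗᵢ (Sp n) ℂ) f g
    simp only [Set.mem_ofPred_eq, h] at hf hg ⊢
    filter_upwards [hf, hg, Lp.coeFn_add (𝓕 f : L2 n) (𝓕 g : L2 n)] with η h1 h2 h3 hr
    rw [h3, Pi.add_apply, h1 hr, h2 hr, add_zero]
  smul_mem' := by
    intro c f hf
    have h : (𝓕 (c • f) : L2 n) = c • 𝓕 f := map_smul (Lp.fourierTransformₗᵢ (Sp n) ℂ) c f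
    simp only [Set.mem_ofPred_eq, h] at hf ⊢
    filter_upwards [hf, Lp.coeFn_smul c (𝓕 f : L2 n)] with η h1 h2 hr
    rw [h2, Pi.smul_apply, h1 hr, smul_zero]

/-- The function underlying an element of `H^k`. -/
def evalZero (n k : ℕ) : (PiLp 2 fun _ : MultiIndex n k => L2 n) →ₗ[ℂ] L2 n where
  toFun F := F (MultiIndex.zero n k)
  map_add' _ _ := rfl
  map_smul' _ _ := rfl

/-- The high frequency space `H^k_(∞)`: the `f ∈ H^k` with Fourier support in `{|ξ| ≥ r}`,
with the norm of `H^k`. -/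
def HHigh (n k : ℕ) (r : ℝ) : Submodule ℂ (PiLp 2 fun _ : MultiIndex n k => L2 n) :=
  H n k ⊓ (L2High n r).comap (evalZero n k)

/-- The space `H^s_(∞) × (H^{s-1}_(∞))ⁿ` of pairs `(φ, m)`, with the norm
`(‖φ‖²_{H^s} + ∑_j ‖m_j‖²_{H^{s-1}})^{1/2}`. -/
abbrev X (n s : ℕ) (r : ℝ) : Type :=
  WithLp 2 (HHigh n s r × PiLp 2 fun _ : Fin n => HHigh n (s - 1) r)

instance (n k : ℕ) (r : ℝ) : NormedAddCommGroup (HHigh n k r) := Submodule.normedAddCommGroup _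

instance (n k : ℕ) (r : ℝ) : NormedSpace ℂ (HHigh n k r) := Submodule.normedSpace _

instance (n s : ℕ) (r : ℝ) : NormedAddCommGroup (X n s r) :=
  WithLp.instProdNormedAddCommGroup 2 _ _

instance (n s : ℕ) (r : ℝ) : NormedSpace ℂ (X n s r) :=
  WithLp.instProdNormedSpace 2 ℂ _ _

/-- The density component `φ ∈ L²` of `u = (φ, m)`. -/
def X.phi {n s : ℕ} {r : ℝ} (u : X n s r) : L2 n := evalZero n s u.fst

/-- The component `m_j ∈ L²` of `u = (φ, m)`. -/
def X.mom {n s : ℕ} {r : ℝ} (u : X n s r) (j : Fin n) : L2 n := evalZero n (s - 1) (u.snd j)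

/-- The divergence of a vector field of distributions. -/
def divergence {n : ℕ} (m : Fin n → 𝓢'(Sp n, ℂ)) : 𝓢'(Sp n, ℂ) := ∑ j, ∂_{(e j : Sp n)} (m j)

/-- `v = A u` in the sense of distributions, where
`A (φ, m) = (div m, -κ ∇Δφ - ν Δm - ν' ∇div m)`. As a relation on `X n s r` this is the graph of
the operator `A` with the domain of all `u ∈ X n s r` such that `A u ∈ X n s r`. -/
def IsA (ν ν' κ : ℝ) {n s : ℕ} {r : ℝ} (u v : X n s r) : Prop :=
  toDistr v.phi = divergence (fun j => toDistr (u.mom j)) ∧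
  ∀ j : Fin n, toDistr (v.mom j) =
    -((κ : ℂ) • ∂_{(e j : Sp n)} (Δ (toDistr u.phi)))
      - (ν : ℂ) • Δ (toDistr (u.mom j))
      - (ν' : ℂ) • ∂_{(e j : Sp n)} (divergence fun i => toDistr (u.mom i))

/-- The complex number `√(1 - K²)`, where `K = 2√κ / (ν + ν')`. -/
def rootK (ν ν' κ : ℝ) : ℂ := ((1 - (2 * √κ / (ν + ν')) ^ 2 : ℝ) : ℂ) ^ (1 / 2 : ℂ)

/-- `λ₊(ξ) = -((ν + ν')/2) (|ξ|² + |ξ|² √(1 - K²))`. -/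
def lamP (ν ν' κ : ℝ) {n : ℕ} (ξ : Sp n) : ℂ :=
  -(((ν + ν') / 2 : ℝ) : ℂ) * ((‖ξ‖ ^ 2 : ℝ) + (‖ξ‖ ^ 2 : ℝ) * rootK ν ν' κ)

/-- `λ₋(ξ) = -((ν + ν')/2) (|ξ|² - |ξ|² √(1 - K²))`. -/
def lamM (ν ν' κ : ℝ) {n : ℕ} (ξ : Sp n) : ℂ :=
  -(((ν + ν') / 2 : ℝ) : ℂ) * ((‖ξ‖ ^ 2 : ℝ) - (‖ξ‖ ^ 2 : ℝ) * rootK ν ν' κ)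

/-- `(a e^{bt} - b e^{at}) / (a - b)`, continuously extended to `a = b`. -/
def coefA (a b : ℂ) (t : ℝ) : ℂ :=
  if a = b then (1 - a * t) * Complex.exp (a * t)
  else (a * Complex.exp (b * t) - b * Complex.exp (a * t)) / (a - b)

/-- `(e^{at} - e^{bt}) / (a - b)`, continuously extended to `a = b`. -/
def coefB (a b : ℂ) (t : ℝ) : ℂ :=
  if a = b then t * Complex.exp (a * t)
  else (Complex.exp (a * t) - Complex.exp (b * t)) / (a - b)

/-- `(a e^{at} - b e^{bt}) / (a - b)`, continuously extended to `a = b`. -/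
def coefC (a b : ℂ) (t : ℝ) : ℂ :=
  if a = b then (1 + a * t) * Complex.exp (a * t)
  else (a * Complex.exp (a * t) - b * Complex.exp (b * t)) / (a - b)

/-- The entry `S₁₁` of the solution matrix of the linearized system at the frequency `ξ`. -/
def S11 (ν ν' κ : ℝ) {n : ℕ} (t : ℝ) (ξ : Sp n) : ℂ :=
  coefA (lamP ν ν' κ ξ) (lamM ν ν' κ ξ) t

/-- The entries of the row `S₁₂`. -/
def S12 (ν ν' κ : ℝ) {n : ℕ} (t : ℝ) (ξ : Sp n) (j : Fin n) : ℂ :=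
  -Complex.I * coefB (lamP ν ν' κ ξ) (lamM ν ν' κ ξ) t * (ξ j : ℂ)

/-- The entries of the column `S₂₁`. -/
def S21 (ν ν' κ : ℝ) {n : ℕ} (t : ℝ) (ξ : Sp n) (i : Fin n) : ℂ :=
  -Complex.I * (ξ i : ℂ) * κ * (‖ξ‖ ^ 2 : ℝ) * coefB (lamP ν ν' κ ξ) (lamM ν ν' κ ξ) t

/-- The entries of the block `S₂₂`. -/
def S22 (ν ν' κ : ℝ) {n : ℕ} (t : ℝ) (ξ : Sp n) (i j : Fin n) : ℂ :=
  Complex.exp (-(ν * ‖ξ‖ ^ 2 * t : ℝ)) * (if i = j then 1 else 0)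
    + (coefC (lamP ν ν' κ ξ) (lamM ν ν' κ ξ) t - Complex.exp (-(ν * ‖ξ‖ ^ 2 * t : ℝ)))
      * ((ξ i : ℂ) * (ξ j : ℂ) / (‖ξ‖ ^ 2 : ℝ))

/-- `v = S(t) u`: the Fourier transform of `v` is the solution matrix at time `t` times the
Fourier transform of `u`. (Mathlib's Fourier variable is `η = ξ / 2π`.) -/
def IsSolutionAt (ν ν' κ : ℝ) {n s : ℕ} {r : ℝ} (t : ℝ) (u v : X n s r) : Prop :=
  (∀ᵐ η : Sp n, (𝓕 v.phi : L2 n) η =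
    S11 ν ν' κ t ((2 * Real.pi) • η) * (𝓕 u.phi : L2 n) η
      + ∑ j, S12 ν ν' κ t ((2 * Real.pi) • η) j * (𝓕 (u.mom j) : L2 n) η) ∧
  ∀ i : Fin n, ∀ᵐ η : Sp n, (𝓕 (v.mom i) : L2 n) η =
    S21 ν ν' κ t ((2 * Real.pi) • η) i * (𝓕 u.phi : L2 n) η
      + ∑ j, S22 ν ν' κ t ((2 * Real.pi) • η) i j * (𝓕 (u.mom j) : L2 n) η

/-- A `C⁰`-semigroup of bounded linear operators. -/
structure IsC0Semigroup {Y : Type*} [NormedAddCommGroup Y] [NormedSpace ℂ Y]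
    (S : ℝ≥0 → Y →L[ℂ] Y) : Prop where
  map_zero : S 0 = ContinuousLinearMap.id ℂ Y
  map_add : ∀ t₁ t₂ : ℝ≥0, S (t₁ + t₂) = (S t₁).comp (S t₂)
  tendsto_zero : ∀ y : Y, Tendsto (fun t => S t y) (𝓝 0) (𝓝 y)

/-- `w` is the value at `y` of the infinitesimal generator of `S`: the difference quotients
`(S(h) y - y) / h` converge to `w` as `h ↓ 0`. The generator's domain consists of the `y` for
which such a `w` exists. -/
def IsGeneratorAt {Y : Type*} [NormedAddCommGroup Y] [NormedSpace ℂ Y]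
    (S : ℝ≥0 → Y →L[ℂ] Y) (y w : Y) : Prop :=
  Tendsto (fun h : ℝ≥0 => ((h : ℝ)⁻¹ : ℂ) • (S h y - y)) (𝓝[>] 0) (𝓝 w)

end NSK

end

/-!
Multiplying the Fourier transform of `u = (φ, m)` by the Sobolev weights `(w_s, w_{s-1})` identifies
`X` with `L²({|ξ| ≥ r}; ℂ × ℂⁿ)` and turns `-A` into multiplication by a matrix symbol `b(ξ)`. By
uniqueness for linear ODEs, the weighted solution matrix is `exp(t b(ξ))`. If the exponentials
`exp(t b(ξ))` are bounded uniformly in `ξ` and `t ≥ 0`, dominated convergence shows that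
multiplication by them is a `C⁰`-semigroup, generated by multiplication by `b` on its maximal
domain.

For the uniform bound, note that `λ±` are `|ξ|²` times constants of negative real part (or, for
`κ = 0`, zero), so `(λ₊e^{λ₋t} - λ₋e^{λ₊t}) / (λ₊ - λ₋)`, `|ξ|² (e^{λ₊t} - e^{λ₋t}) / (λ₊ - λ₋)` and
`(λ₊e^{λ₊t} - λ₋e^{λ₋t}) / (λ₊ - λ₋)` are functions of `|ξ|² t` alone, bounded on `[0, ∞)`. The
remaining factors `|ξ|^{±1}` of the off-diagonal entries are absorbed by the weights, since
`w_s ≈ |ξ| w_{s-1}` on `|ξ| ≥ r`.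
-/

noncomputable section

open scoped Real

namespace NSK

section LpSpaces

variable {𝕜 Ω E F : Type*} [MeasurableSpace Ω] {μ : Measure Ω} {p : ℝ≥0∞}
  [NormedAddCommGroup E] [NormedAddCommGroup F]

theorem tendsto_Lp_of_dominated [Fact (1 ≤ p)] (hp : p ≠ ∞) {ι : Type*} {l : Filter ι}
    [l.IsCountablyGenerated] {u : ι → Lp E p μ} {v : Lp E p μ} {U : ι → Ω → E} {bound : Ω → ℝ}
    (hbound : MemLp bound p μ) (huU : ∀ i, u i =ᵐ[μ] U i)
    (hle : ∀ᶠ i in l, ∀ᵐ x ∂μ, ‖U i x - v x‖ ≤ bound x)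
    (hlim : ∀ᵐ x ∂μ, Tendsto (fun i => U i x) l (𝓝 (v x))) :
    Tendsto u l (𝓝 v) := by
  have hp₀ : p ≠ 0 := (zero_lt_one.trans_le Fact.out).ne'
  have hq : 0 < p.toReal := ENNReal.toReal_pos hp₀ hp
  have hnorm : ∀ i, eLpNorm (⇑(u i) - ⇑v) p μ
      = (∫⁻ x, ‖U i x - v x‖ₑ ^ p.toReal ∂μ) ^ (1 / p.toReal) := fun i => by
    have h : (⇑(u i) - ⇑v) =ᵐ[μ] fun x => U i x - v x := (huU i).sub (ae_eq_refl v)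
    rw [eLpNorm_congr_ae h, eLpNorm_eq_lintegral_rpow_enorm_toReal hp₀ hp]
  have hlintegral : Tendsto (fun i => ∫⁻ x, ‖U i x - v x‖ₑ ^ p.toReal ∂μ) l (𝓝 (∫⁻ _, 0 ∂μ)) := by
    refine tendsto_lintegral_filter_of_dominated_convergence'
      (fun x => ‖bound x‖ₑ ^ p.toReal) (Eventually.of_forall fun i => ?_) ?_
      (lintegral_rpow_enorm_lt_top_of_eLpNorm_lt_top hp₀ hp hbound.2).ne ?_
    · exact ((((Lp.aestronglyMeasurable (u i)).congr (huU i)).sub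
        (Lp.aestronglyMeasurable v)).enorm).pow_const _
    · filter_upwards [hle] with i hi
      filter_upwards [hi] with x hx
      gcongr
      exact enorm_le_iff_norm_le.2 (hx.trans (le_abs_self _))
    · filter_upwards [hlim] with x hx
      simpa [Function.comp_def, hq] using
        (ENNReal.continuous_rpow_const (y := p.toReal)).tendsto _ |>.comp (hx.sub_const (v x)).enorm
  rw [Lp.tendsto_Lp_iff_tendsto_eLpNorm']
  simp only [hnorm]
  simpa [Function.comp_def, hq] using
    (ENNReal.continuous_rpow_const (y := 1 / p.toReal)).tendsto _ |>.comp hlintegral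

variable [NontriviallyNormedField 𝕜] [NormedSpace 𝕜 E] [NormedSpace 𝕜 F] {A : Set Ω}

theorem memLp_indicator_coeFn (hA : MeasurableSet A) (f : Lp E p (μ.restrict A)) :
    MemLp (A.indicator f) p μ :=
  (memLp_indicator_iff_restrict hA).2 (Lp.memLp f)

variable (𝕜 μ p) in
/-- Extension by zero from `A`, as an isometry of `Lᵖ` spaces. -/
def lpExtend [Fact (1 ≤ p)] (hA : MeasurableSet A) :
    Lp E p (μ.restrict A) →ₗᵢ[𝕜] Lp E p μ where
  toFun f := (memLp_indicator_coeFn hA f).toLp _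
  map_add' f g := by
    rw [← MemLp.toLp_add]
    refine MemLp.toLp_congr _ _ ?_
    rw [← Set.indicator_add']
    exact (ae_eq_restrict_iff_indicator_ae_eq hA).1 (Lp.coeFn_add f g)
  map_smul' c f := by
    rw [RingHom.id_apply, ← MemLp.toLp_const_smul]
    refine MemLp.toLp_congr _ _ ?_
    refine EventuallyEq.trans ?_ (.of_eq (Set.indicator_const_smul A c f))
    exact (ae_eq_restrict_iff_indicator_ae_eq hA).1 (Lp.coeFn_smul c f)
  norm_map' f := by
    simp only [LinearMap.coe_mk, AddHom.coe_mk, Lp.norm_toLp]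
    rw [eLpNorm_indicator_eq_eLpNorm_restrict hA, Lp.norm_def]

theorem coeFn_lpExtend [Fact (1 ≤ p)] (hA : MeasurableSet A) (f : Lp E p (μ.restrict A)) :
    lpExtend 𝕜 μ p hA f =ᵐ[μ] A.indicator f :=
  MemLp.coeFn_toLp (memLp_indicator_coeFn hA f)

end LpSpaces

section LpProducts

variable {𝕜 Ω E F ι : Type*} [MeasurableSpace Ω] {μ : Measure Ω} {p : ℝ≥0∞} [Fact (1 ≤ p)]
  [NontriviallyNormedField 𝕜] [NormedAddCommGroup E] [NormedSpace 𝕜 E] [NormedAddCommGroup F]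
  [NormedSpace 𝕜 F] [Fintype ι]

variable (𝕜 E F ι μ p) in
/-- The components of an `Lᵖ` function with values in `E × Fᶦ`. -/
def lpComponents : Lp (E × (ι → F)) p μ →L[𝕜] Lp E p μ × (ι → Lp F p μ) :=
  ((ContinuousLinearMap.fst 𝕜 E (ι → F)).compLpL p μ).prod
    (ContinuousLinearMap.pi fun i =>
      ((ContinuousLinearMap.proj i).comp (ContinuousLinearMap.snd 𝕜 E (ι → F))).compLpL p μ)

theorem coeFn_lpComponents_fst (f : Lp (E × (ι → F)) p μ) :
    (lpComponents 𝕜 E F ι μ p f).1 =ᵐ[μ] fun x => (f x).1 :=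
  (ContinuousLinearMap.fst 𝕜 E (ι → F)).coeFn_compLpL f

theorem coeFn_lpComponents_snd (f : Lp (E × (ι → F)) p μ) (i : ι) :
    (lpComponents 𝕜 E F ι μ p f).2 i =ᵐ[μ] fun x => (f x).2 i :=
  ((ContinuousLinearMap.proj i).comp (ContinuousLinearMap.snd 𝕜 E (ι → F))).coeFn_compLpL f

variable [DecidableEq ι]

variable (𝕜 E F) in
/-- The inclusion of the `i`-th copy of `F` into `E × Fᶦ`. -/
def inrSingle (i : ι) : F →L[𝕜] E × (ι → F) :=
  (ContinuousLinearMap.inr 𝕜 E (ι → F)).comp (ContinuousLinearMap.single 𝕜 (fun _ => F) i)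

variable (𝕜 E F ι μ p) in
/-- The `Lᵖ` function with values in `E × Fᶦ` that has the given components. -/
def lpOfComponents : Lp E p μ × (ι → Lp F p μ) →L[𝕜] Lp (E × (ι → F)) p μ :=
  ((ContinuousLinearMap.inl 𝕜 E (ι → F)).compLpL p μ).coprod
    (∑ i, (inrSingle 𝕜 E F i).compLpL p μ ∘L ContinuousLinearMap.proj i)

theorem coeFn_lpOfComponents (g : Lp E p μ × (ι → Lp F p μ)) :
    lpOfComponents 𝕜 E F ι μ p g =ᵐ[μ] fun x => (g.1 x, fun i => g.2 i x) := by
  have hsum : lpOfComponents 𝕜 E F ι μ p g = (ContinuousLinearMap.inl 𝕜 E (ι → F)).compLpL p μ g.1 +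
      ∑ i, (inrSingle 𝕜 E F i).compLpL p μ (g.2 i) := by
    simp [lpOfComponents]
  have h_inr : ∀ᵐ x ∂μ, ∀ i, (inrSingle 𝕜 E F i).compLpL p μ (g.2 i) x =
      inrSingle 𝕜 E F i (g.2 i x) :=
    ae_all_iff.2 fun i => (inrSingle 𝕜 E F i).coeFn_compLpL (g.2 i)
  rw [hsum]
  filter_upwards [Lp.coeFn_add ((ContinuousLinearMap.inl 𝕜 E (ι → F)).compLpL p μ g.1)
      (∑ i, (inrSingle 𝕜 E F i).compLpL p μ (g.2 i)),
    Lp.coeFn_fun_finsetSum Finset.univ fun i => (inrSingle 𝕜 E F i).compLpL p μ (g.2 i),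
    (ContinuousLinearMap.inl 𝕜 E (ι → F)).coeFn_compLpL g.1, h_inr]
    with x hx_add hx_sum hx_inl hx_inr
  rw [hx_add, Pi.add_apply, hx_sum, hx_inl]
  simp only [hx_inr]
  ext i
  · simp [inrSingle, Prod.fst_sum]
  · simp [inrSingle, Prod.snd_sum, Finset.sum_apply, Pi.single_apply]

variable (𝕜 E F ι μ p) in
/-- An `Lᵖ` function with values in `E × Fᶦ` is a tuple of `Lᵖ` functions. -/
def lpProdPiEquiv : (Lp E p μ × (ι → Lp F p μ)) ≃L[𝕜] Lp (E × (ι → F)) p μ :=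
  ContinuousLinearEquiv.equivOfInverse (lpOfComponents 𝕜 E F ι μ p) (lpComponents 𝕜 E F ι μ p)
    (fun g => by
      refine Prod.ext (Lp.ext ?_) (funext fun i => Lp.ext ?_)
      · filter_upwards [coeFn_lpComponents_fst (𝕜 := 𝕜) (lpOfComponents 𝕜 E F ι μ p g),
          coeFn_lpOfComponents (𝕜 := 𝕜) g] with x h₁ h₂
        rw [h₁, h₂]
      · filter_upwards [coeFn_lpComponents_snd (𝕜 := 𝕜) (lpOfComponents 𝕜 E F ι μ p g) i,
          coeFn_lpOfComponents (𝕜 := 𝕜) g] with x h₁ h₂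
        rw [h₁, h₂])
    (fun f => by
      refine Lp.ext ?_
      filter_upwards [coeFn_lpComponents_fst (𝕜 := 𝕜) f,
        ae_all_iff.2 fun i => coeFn_lpComponents_snd (𝕜 := 𝕜) f i,
        coeFn_lpOfComponents (𝕜 := 𝕜) (lpComponents 𝕜 E F ι μ p f)] with x h₁ h₂ h₃
      rw [h₃]
      exact Prod.ext h₁ (funext h₂))

end LpProducts

section OperatorExponential

variable {V : Type*} [NormedAddCommGroup V] [NormedSpace ℂ V] [CompleteSpace V]

theorem continuous_clm_exp : Continuous (NormedSpace.exp : (V →L[ℂ] V) → V →L[ℂ] V) :=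
  let _ : NormedAlgebra ℚ (V →L[ℂ] V) := NormedAlgebra.restrictScalars ℚ ℂ _
  NormedSpace.exp_continuous

theorem clm_exp_add_smul (b : V →L[ℂ] V) (t s : ℝ) :
    NormedSpace.exp ((t + s) • b) = NormedSpace.exp (t • b) * NormedSpace.exp (s • b) := by
  let _ : NormedAlgebra ℚ (V →L[ℂ] V) := NormedAlgebra.restrictScalars ℚ ℂ _
  rw [add_smul]
  exact NormedSpace.exp_add_of_commute (((Commute.refl b).smul_left t).smul_right s)

theorem hasDerivAt_clm_exp_apply (b : V →L[ℂ] V) (y : V) (t : ℝ) :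
    HasDerivAt (fun t : ℝ => NormedSpace.exp (t • b) y) (NormedSpace.exp (t • b) (b y)) t :=
  ((ContinuousLinearMap.apply ℂ V y).restrictScalars ℝ).hasFDerivAt.comp_hasDerivAt t
    (hasDerivAt_exp_smul_const b t)

theorem hasDerivAt_clm_exp_apply' (b : V →L[ℂ] V) (y : V) (t : ℝ) :
    HasDerivAt (fun t : ℝ => NormedSpace.exp (t • b) y) (b (NormedSpace.exp (t • b) y)) t :=
  ((ContinuousLinearMap.apply ℂ V y).restrictScalars ℝ).hasFDerivAt.comp_hasDerivAt t
    (hasDerivAt_exp_smul_const' b t)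

theorem eq_clm_exp_of_hasDerivAt {b : V →L[ℂ] V} {y : ℝ → V}
    (hy : ∀ t, HasDerivAt y (b (y t)) t) (t : ℝ) :
    y t = NormedSpace.exp (t • b) (y 0) :=
  congrFun (ODE_solution_unique_univ (v := fun _ => b) (s := fun _ => Set.univ) (t₀ := 0)
    (g := fun t : ℝ => NormedSpace.exp (t • b) (y 0))
    (fun _ => b.lipschitz.lipschitzOnWith) (fun t => ⟨hy t, trivial⟩)
    (fun t => ⟨hasDerivAt_clm_exp_apply' b (y 0) t, trivial⟩) (by simp)) t

theorem norm_clm_exp_smul_apply_sub_le {b : V →L[ℂ] V} {C : ℝ}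
    (hb : ∀ t : ℝ, 0 ≤ t → ‖NormedSpace.exp (t • b)‖ ≤ C) (y : V) {t : ℝ} (ht : 0 ≤ t) :
    ‖NormedSpace.exp (t • b) y - y‖ ≤ C * ‖b y‖ * t := by
  simpa using norm_image_sub_le_of_norm_deriv_le_segment' (a := (0 : ℝ)) (b := t)
    (fun s _ => (hasDerivAt_clm_exp_apply b y s).hasDerivWithinAt)
    (fun s hs => ContinuousLinearMap.le_of_opNorm_le _ (hb s hs.1) _) t ⟨ht, le_rfl⟩

theorem tendsto_clm_exp_smul_slope (b : V →L[ℂ] V) (y : V) :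
    Tendsto (fun h : ℝ≥0 => ((h : ℝ)⁻¹ : ℂ) • (NormedSpace.exp ((h : ℝ) • b) y - y)) (𝓝[>] 0)
      (𝓝 (b y)) := by
  have hcoe : Tendsto (fun h : ℝ≥0 => (h : ℝ)) (𝓝[>] 0) (𝓝[>] 0) :=
    tendsto_nhdsWithin_iff.2 ⟨(NNReal.continuous_coe.tendsto 0).mono_left nhdsWithin_le_nhds,
      eventually_mem_nhdsWithin.mono fun _ => NNReal.coe_pos.2⟩
  have h := (hasDerivAt_clm_exp_apply b y 0).tendsto_slope_zero_right.comp hcoe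
  simp only [zero_smul, NormedSpace.exp_zero, zero_add] at h
  refine h.congr fun t => ?_
  rw [Function.comp_apply, ← Complex.ofReal_inv, Complex.coe_smul]
  rfl

end OperatorExponential

section MultiplicationSemigroup

variable {Ω V : Type*} [MeasurableSpace Ω] {μ : Measure Ω} [NormedAddCommGroup V]
  [NormedSpace ℂ V]

/-- A measurable field `b` of operators such that `‖exp (t b(x))‖ ≤ C` for all `t ≥ 0` and almost
all `x`. The operators `b(x)` themselves may be unbounded in `x`. -/
structure IsStableSymbol (b : Ω → V →L[ℂ] V) (μ : Measure Ω) (C : ℝ) : Prop where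
  aestronglyMeasurable : AEStronglyMeasurable b μ
  norm_exp_le : ∀ᵐ x ∂μ, ∀ t : ℝ, 0 ≤ t → ‖NormedSpace.exp (t • b x)‖ ≤ C

variable [CompleteSpace V] {b : Ω → V →L[ℂ] V} {C : ℝ} {p : ℝ≥0∞} [Fact (1 ≤ p)]

theorem IsStableSymbol.memLp_top_exp (hb : IsStableSymbol b μ C) (t : ℝ≥0) :
    MemLp (fun x => NormedSpace.exp ((t : ℝ) • b x)) ∞ μ :=
  memLp_top_of_bound
    (continuous_clm_exp.comp_aestronglyMeasurable (hb.aestronglyMeasurable.const_smul (t : ℝ))) C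
    (hb.norm_exp_le.mono fun _ hx => hx t t.2)

variable (p) in
/-- The semigroup of multiplication operators `f ↦ exp (t b(·)) f` on `Lᵖ`. -/
def mulSemigroup (hb : IsStableSymbol b μ C) (t : ℝ≥0) : Lp V p μ →L[ℂ] Lp V p μ :=
  (ContinuousLinearMap.id ℂ (V →L[ℂ] V)).holderL μ ∞ p p ((hb.memLp_top_exp t).toLp _)

variable (hb : IsStableSymbol b μ C)
include hb

theorem coeFn_mulSemigroup (t : ℝ≥0) (f : Lp V p μ) :
    mulSemigroup p hb t f =ᵐ[μ] fun x => NormedSpace.exp ((t : ℝ) • b x) (f x) := by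
  filter_upwards [(ContinuousLinearMap.id ℂ (V →L[ℂ] V)).coeFn_holder (r := p)
    ((hb.memLp_top_exp t).toLp _) f, (hb.memLp_top_exp t).coeFn_toLp] with x h₁ h₂
  rw [← h₂]
  exact h₁

theorem norm_mulSemigroup_le (t : ℝ≥0) (f : Lp V p μ) : ‖mulSemigroup p hb t f‖ ≤ C * ‖f‖ := by
  refine Lp.norm_le_mul_norm_of_ae_le_mul ?_
  filter_upwards [hb.norm_exp_le, coeFn_mulSemigroup hb t f] with x hx hSf
  rw [hSf]
  exact ContinuousLinearMap.le_of_opNorm_le _ (hx t t.2) _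

theorem continuous_mulSemigroup_apply (hp : p ≠ ∞) (f : Lp V p μ) :
    Continuous fun t => mulSemigroup p hb t f := by
  refine continuous_iff_continuousAt.2 fun t => ?_
  refine tendsto_Lp_of_dominated hp (bound := fun x => (2 * C) * ‖f x‖)
    ((Lp.memLp f).norm.const_mul _) (fun s => coeFn_mulSemigroup hb s f)
    (Eventually.of_forall fun s => ?_) ?_
  · filter_upwards [hb.norm_exp_le, coeFn_mulSemigroup hb t f] with x hx hSf
    rw [hSf, two_mul, add_mul]
    exact norm_sub_le_of_le (ContinuousLinearMap.le_of_opNorm_le _ (hx s s.2) _)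
      (ContinuousLinearMap.le_of_opNorm_le _ (hx t t.2) _)
  · filter_upwards [coeFn_mulSemigroup hb t f] with x hSf
    rw [hSf]
    exact ((continuous_clm_exp.comp (NNReal.continuous_coe.smul continuous_const)).clm_apply
      continuous_const).tendsto t

theorem isC0Semigroup_mulSemigroup (hp : p ≠ ∞) : IsC0Semigroup (mulSemigroup p hb) := by
  have hzero : mulSemigroup p hb 0 = ContinuousLinearMap.id ℂ (Lp V p μ) := by
    ext1 f
    refine Lp.ext ?_
    filter_upwards [coeFn_mulSemigroup hb 0 f] with x hx
    simpa using hx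
  refine ⟨hzero, fun t s => ?_, fun f => ?_⟩
  · ext1 f
    refine Lp.ext ?_
    filter_upwards [coeFn_mulSemigroup hb (t + s) f, coeFn_mulSemigroup hb s f,
      coeFn_mulSemigroup hb t (mulSemigroup p hb s f)] with x h_add h_s h_ts
    rw [h_add, ContinuousLinearMap.comp_apply, h_ts, h_s, NNReal.coe_add, clm_exp_add_smul,
      mul_apply_eq_comp]
  · simpa [hzero] using (continuous_mulSemigroup_apply hb hp f).tendsto 0

theorem coeFn_mulSemigroup_slope (f : Lp V p μ) (h : ℝ≥0) :
    (((h : ℝ)⁻¹ : ℂ) • (mulSemigroup p hb h f - f) : Lp V p μ) =ᵐ[μ]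
      fun x => ((h : ℝ)⁻¹ : ℂ) • (NormedSpace.exp ((h : ℝ) • b x) (f x) - f x) := by
  filter_upwards [Lp.coeFn_smul ((h : ℝ)⁻¹ : ℂ) (mulSemigroup p hb h f - f),
    Lp.coeFn_sub (mulSemigroup p hb h f) f, coeFn_mulSemigroup hb h f] with x h_smul h_sub h_exp
  rw [h_smul, Pi.smul_apply, h_sub, Pi.sub_apply, h_exp]

theorem isGeneratorAt_mulSemigroup_iff (hp : p ≠ ∞) (f w : Lp V p μ) :
    IsGeneratorAt (mulSemigroup p hb) f w ↔ ∀ᵐ x ∂μ, w x = b x (f x) := by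
  refine ⟨fun hw => ?_, fun hw => ?_⟩
  · obtain ⟨ns, hns, hae⟩ := (tendstoInMeasure_of_tendsto_Lp hw).exists_seq_tendsto_ae'
    filter_upwards [hae, ae_all_iff.2 fun i : ℕ => coeFn_mulSemigroup_slope hb f (ns i)]
      with x hx hslope
    simp only [hslope] at hx
    exact tendsto_nhds_unique hx ((tendsto_clm_exp_smul_slope (b x) (f x)).comp hns)
  · refine tendsto_Lp_of_dominated hp (bound := fun x => (C + 1) * ‖w x‖)
      ((Lp.memLp w).norm.const_mul _) (fun h => coeFn_mulSemigroup_slope hb f h) ?_ ?_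
    · filter_upwards [self_mem_nhdsWithin] with h hh
      have hpos : (0 : ℝ) < h := NNReal.coe_pos.2 hh
      filter_upwards [hb.norm_exp_le, hw] with x hx hwx
      have hslope : ‖((h : ℝ)⁻¹ : ℂ) • (NormedSpace.exp ((h : ℝ) • b x) (f x) - f x)‖
          ≤ C * ‖w x‖ := by
        rw [norm_smul, norm_inv, Complex.norm_real, Real.norm_of_nonneg hpos.le,
          inv_mul_le_iff₀' hpos, hwx]
        exact norm_clm_exp_smul_apply_sub_le hx (f x) hpos.le
      rw [add_one_mul]
      exact norm_sub_le_of_le hslope le_rfl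
    · filter_upwards [hw] with x hwx
      rw [hwx]
      exact tendsto_clm_exp_smul_slope (b x) (f x)

end MultiplicationSemigroup

section Conjugation

variable {Y Z : Type*} [NormedAddCommGroup Y] [NormedSpace ℂ Y] [NormedAddCommGroup Z]
  [NormedSpace ℂ Z]

/-- The family `J⁻¹ T(t) J` of operators on `Y`. -/
def conjFamily (J : Y ≃L[ℂ] Z) (T : ℝ≥0 → Z →L[ℂ] Z) (t : ℝ≥0) : Y →L[ℂ] Y :=
  (J.symm : Z →L[ℂ] Y) ∘L T t ∘L (J : Y →L[ℂ] Z)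

variable (J : Y ≃L[ℂ] Z) {T : ℝ≥0 → Z →L[ℂ] Z}

theorem conjFamily_apply (t : ℝ≥0) (y : Y) : conjFamily J T t y = J.symm (T t (J y)) := rfl

theorem apply_conjFamily (t : ℝ≥0) (y : Y) : J (conjFamily J T t y) = T t (J y) :=
  J.apply_symm_apply _

theorem isC0Semigroup_conjFamily (hT : IsC0Semigroup T) : IsC0Semigroup (conjFamily J T) where
  map_zero := by
    ext1 y
    simp [conjFamily_apply, hT.map_zero]
  map_add t s := by
    ext1 y
    simp [conjFamily_apply, hT.map_add]
  tendsto_zero y := by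
    simpa [Function.comp_def, conjFamily_apply] using
      (J.symm.continuous.tendsto _).comp (hT.tendsto_zero (J y))

theorem isGeneratorAt_conjFamily_iff (y w : Y) :
    IsGeneratorAt (conjFamily J T) y w ↔ IsGeneratorAt T (J y) (J w) := by
  unfold IsGeneratorAt
  rw [J.toHomeomorph.isInducing.tendsto_nhds_iff]
  refine tendsto_congr fun h => ?_
  simp [apply_conjFamily]

theorem exists_norm_conjFamily_le {C : ℝ} (hC : ∀ t z, ‖T t z‖ ≤ C * ‖z‖) :
    ∃ C' : ℝ, 0 < C' ∧ ∀ t y, ‖conjFamily J T t y‖ ≤ C' * ‖y‖ := by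
  set a := ‖(J.symm : Z →L[ℂ] Y)‖
  set c := ‖(J : Y →L[ℂ] Z)‖
  refine ⟨a * (|C| * c) + 1, by positivity, fun t y => ?_⟩
  calc ‖conjFamily J T t y‖ ≤ a * ‖T t (J y)‖ := (J.symm : Z →L[ℂ] Y).le_opNorm _
    _ ≤ a * (|C| * (c * ‖y‖)) := by
      gcongr
      refine (hC t _).trans ?_
      gcongr
      · exact le_abs_self C
      · exact (J : Y →L[ℂ] Z).le_opNorm y
    _ ≤ (a * (|C| * c) + 1) * ‖y‖ := by linarith [norm_nonneg y]

end Conjugation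

theorem continuousOn_clm_apply_of_norm_le {𝕜 I Y Z : Type*} [NontriviallyNormedField 𝕜]
    [TopologicalSpace I] [NormedAddCommGroup Y] [NormedSpace 𝕜 Y] [NormedAddCommGroup Z]
    [NormedSpace 𝕜 Z] {S : I → Y →L[𝕜] Z} {C : ℝ} (hC : ∀ t y, ‖S t y‖ ≤ C * ‖y‖)
    (hS : ∀ y, Continuous fun t => S t y) {A : Set I} {u : I → Y} (hu : ContinuousOn u A) :
    ContinuousOn (fun t => S t (u t)) A := by
  intro t ht
  have hdiff : Tendsto (fun s => S s (u s - u t)) (𝓝[A] t) (𝓝 0) := by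
    refine squeeze_zero_norm (fun s => hC s _) ?_
    simpa using ((hu t ht).sub_const (u t)).norm.const_mul C
  simpa [ContinuousWithinAt] using
    hdiff.add (((hS (u t)).tendsto t).mono_left nhdsWithin_le_nhds)

section FourierCalculus

variable {n : ℕ} {T T' : 𝓢'(Sp n, ℂ)} {h h' : Sp n → ℂ}

/-- The tempered distribution `T` has as Fourier transform the locally integrable function `h`. -/
structure HasFourier (T : 𝓢'(Sp n, ℂ)) (h : Sp n → ℂ) : Prop where
  locallyIntegrable : LocallyIntegrable h
  integrable : ∀ φ : 𝓢(Sp n, ℂ), Integrable fun η => φ η * h η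
  apply_eq : ∀ φ : 𝓢(Sp n, ℂ), 𝓕 T φ = ∫ η, φ η * h η

theorem hasFourier_toDistr (f : L2 n) : HasFourier (toDistr f) (𝓕 f : L2 n) where
  locallyIntegrable := MemLp.locallyIntegrable (Lp.memLp (𝓕 f : L2 n)) one_le_two
  integrable φ := (φ.memLp 2).integrable_mul (Lp.memLp (𝓕 f : L2 n))
  apply_eq φ := by
    rw [Lp.fourier_toTemperedDistribution_eq f]
    exact Lp.toTemperedDistribution_apply _ φ

theorem HasFourier.ae_eq (hT : HasFourier T h) (hT' : HasFourier T h') : h =ᵐ[volume] h' := by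
  refine ae_eq_of_integral_contDiff_smul_eq hT.locallyIntegrable hT'.locallyIntegrable
    fun g g_smooth g_compact => ?_
  have g_compact' : HasCompactSupport (Complex.ofRealCLM ∘ g) := g_compact.comp_left rfl
  have g_smooth' : ContDiff ℝ ((⊤ : ℕ∞) : WithTop ℕ∞) (Complex.ofRealCLM ∘ g) := by fun_prop
  simpa using (hT.apply_eq (g_compact'.toSchwartzMap g_smooth')).symm.trans
    (hT'.apply_eq (g_compact'.toSchwartzMap g_smooth'))

theorem HasFourier.eq_of_ae_eq (hT : HasFourier T h) (hT' : HasFourier T' h')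
    (hh : h =ᵐ[volume] h') : T = T' := by
  have hfourier : 𝓕 T = 𝓕 T' := by
    ext φ
    rw [hT.apply_eq, hT'.apply_eq]
    refine integral_congr_ae ?_
    filter_upwards [hh] with x hx
    rw [hx]
  simpa only [FourierTransform.fourierInv_fourier_eq] using
    congrArg (fun S : 𝓢'(Sp n, ℂ) => (𝓕⁻ S : 𝓢'(Sp n, ℂ))) hfourier

theorem HasFourier.toDistr_eq_iff (hT : HasFourier T h) (f : L2 n) :
    toDistr f = T ↔ (𝓕 f : L2 n) =ᵐ[volume] h :=
  ⟨fun hf => (hf ▸ hasFourier_toDistr f).ae_eq hT,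
    fun hf => (hasFourier_toDistr f).eq_of_ae_eq hT hf⟩

theorem hasFourier_zero : HasFourier (0 : 𝓢'(Sp n, ℂ)) (fun _ => 0) where
  locallyIntegrable := locallyIntegrable_zero
  integrable φ := by simp
  apply_eq φ := by
    rw [FourierTransform.fourier_zero]
    simp

theorem HasFourier.add (hT : HasFourier T h) (hT' : HasFourier T' h') :
    HasFourier (T + T') (fun η => h η + h' η) where
  locallyIntegrable := hT.locallyIntegrable.add hT'.locallyIntegrable
  integrable φ := by
    simp only [mul_add]
    exact (hT.integrable φ).add (hT'.integrable φ)
  apply_eq φ := by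
    simp only [mul_add, integral_add (hT.integrable φ) (hT'.integrable φ), ← hT.apply_eq,
      ← hT'.apply_eq]
    rw [FourierAdd.fourier_add]
    rfl

theorem HasFourier.smul (hT : HasFourier T h) (c : ℂ) :
    HasFourier (c • T) (fun η => c * h η) where
  locallyIntegrable := hT.locallyIntegrable.smul c
  integrable φ := by simpa only [mul_left_comm] using (hT.integrable φ).const_mul c
  apply_eq φ := by
    simp only [mul_left_comm _ c, integral_const_mul, ← hT.apply_eq]
    rw [FourierSMul.fourier_smul]
    rfl

theorem HasFourier.neg (hT : HasFourier T h) : HasFourier (-T) (fun η => -h η) := by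
  simpa only [neg_one_smul ℂ T, neg_mul, one_mul] using hT.smul (-1)

theorem HasFourier.sub (hT : HasFourier T h) (hT' : HasFourier T' h') :
    HasFourier (T - T') (fun η => h η - h' η) := by
  simpa only [sub_eq_add_neg] using hT.add hT'.neg

theorem hasFourier_sum {ι : Type*} (s : Finset ι) {T : ι → 𝓢'(Sp n, ℂ)} {h : ι → Sp n → ℂ}
    (hT : ∀ i, HasFourier (T i) (h i)) :
    HasFourier (∑ i ∈ s, T i) (fun η => ∑ i ∈ s, h i η) := by
  classical
  induction s using Finset.induction_on with
  | empty => simpa using hasFourier_zero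
  | insert i s hi ih =>
    simp only [Finset.sum_insert hi]
    exact (hT i).add ih

theorem HasFourier.lineDeriv (hT : HasFourier T h) (j : Fin n) :
    HasFourier (∂_{(e j : Sp n)} T) (fun η => Complex.I * (((2 * π) • η) j : ℝ) * h η) := by
  have hgrowth : (fun η : Sp n => ((inner ℝ η (e j) : ℝ) : ℂ)).HasTemperateGrowth := by fun_prop
  have hmul : ∀ (φ : 𝓢(Sp n, ℂ)) (η : Sp n),
      (2 * π * Complex.I) * ((SchwartzMap.smulLeftCLM ℂ
        (fun η : Sp n => ((inner ℝ η (e j) : ℝ) : ℂ)) φ) η * h η) =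
      φ η * (Complex.I * (((2 * π) • η) j : ℝ) * h η) := by
    intro φ η
    rw [SchwartzMap.smulLeftCLM_apply_apply hgrowth]
    simp [e, EuclideanSpace.inner_single_right]
    ring
  refine ⟨?_, fun φ => ?_, fun φ => ?_⟩
  · have hcont : Continuous fun η : Sp n => Complex.I * (((2 * π) • η) j : ℝ) := by fun_prop
    exact hT.locallyIntegrable.continuous_mul hcont
  · simp only [← hmul]
    exact (hT.integrable _).const_mul _
  · simp only [← hmul, integral_const_mul]
    rw [TemperedDistribution.fourier_lineDerivOp_eq, ← hT.apply_eq]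
    rfl

theorem HasFourier.lineDeriv_pow (hT : HasFourier T h) (j : Fin n) (k : ℕ) :
    HasFourier (((LineDeriv.lineDerivOpCLM ℂ 𝓢'(Sp n, ℂ) (e j : Sp n)) ^ k) T)
      (fun η => (Complex.I * (((2 * π) • η) j : ℝ)) ^ k * h η) := by
  induction k with
  | zero => simpa using hT
  | succ k ih =>
    simp only [pow_succ', mul_assoc, mul_apply_eq_comp, LineDeriv.lineDerivOpCLM_apply]
    simpa only [mul_assoc] using ih.lineDeriv j

theorem HasFourier.list_prod {ι : Type*} {L : ι → 𝓢'(Sp n, ℂ) →L[ℂ] 𝓢'(Sp n, ℂ)}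
    {σ : ι → Sp n → ℂ}
    (hL : ∀ i T h, HasFourier T h → HasFourier (L i T) (fun η => σ i η * h η))
    (hT : HasFourier T h) (l : List ι) :
    HasFourier ((l.map L).prod T) (fun η => (l.map fun i => σ i η).prod * h η) := by
  induction l with
  | nil => simpa using hT
  | cons i l ih =>
    simpa only [List.map_cons, List.prod_cons, mul_assoc, mul_apply_eq_comp] using hL i _ _ ih

/-- The symbol `(iξ)^α` of the differential operator `∂^α`. -/
def derivSymbol (α : Fin n → ℕ) (ξ : Sp n) : ℂ := ∏ j, (Complex.I * (ξ j : ℂ)) ^ α j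

theorem HasFourier.multiDeriv (hT : HasFourier T h) (α : Fin n → ℕ) :
    HasFourier (multiDeriv α T) (fun η => derivSymbol α ((2 * π) • η) * h η) := by
  simp only [derivSymbol, Fin.prod_univ_def]
  exact HasFourier.list_prod (fun j _ _ hT => hT.lineDeriv_pow j (α j)) hT (List.finRange n)

theorem HasFourier.laplacian (hT : HasFourier T h) :
    HasFourier (Δ T) (fun η => -(‖(2 * π) • η‖ ^ 2 : ℝ) * h η) := by
  rw [TemperedDistribution.laplacian_eq_sum (EuclideanSpace.basisFun (Fin n) ℝ)]
  simp only [EuclideanSpace.basisFun_apply]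
  convert hasFourier_sum Finset.univ fun j => (hT.lineDeriv j).lineDeriv j using 2 with η
  simp only [EuclideanSpace.real_norm_sq_eq, Complex.ofReal_sum, Complex.ofReal_pow,
    ← Finset.sum_neg_distrib, Finset.sum_mul]
  refine Finset.sum_congr rfl fun j _ => ?_
  linear_combination (-(((2 * π) • η) j : ℝ) ^ 2 : ℂ) * h η * Complex.I_sq

theorem hasFourier_divergence {m : Fin n → 𝓢'(Sp n, ℂ)} {h : Fin n → Sp n → ℂ}
    (hm : ∀ j, HasFourier (m j) (h j)) :
    HasFourier (divergence m) (fun η => ∑ j, Complex.I * (((2 * π) • η) j : ℝ) * h j η) :=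
  hasFourier_sum Finset.univ fun j => (hm j).lineDeriv j

end FourierCalculus

section Coefficients

theorem coefA_eq (a b : ℂ) (t : ℝ) : coefA a b t = Complex.exp (b * t) - b * coefB a b t := by
  by_cases hab : a = b
  · simp only [coefA, coefB, hab, if_true]
    ring
  · have := sub_ne_zero.2 hab
    simp only [coefA, coefB, hab, if_false]
    field_simp
    ring

theorem coefC_eq (a b : ℂ) (t : ℝ) : coefC a b t = Complex.exp (b * t) + a * coefB a b t := by
  by_cases hab : a = b
  · simp only [coefC, coefB, hab, if_true]
    ring
  · have := sub_ne_zero.2 hab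
    simp only [coefC, coefB, hab, if_false]
    field_simp
    ring

theorem coefB_zero (a b : ℂ) : coefB a b 0 = 0 := by
  simp [coefB]

theorem coefA_zero (a b : ℂ) : coefA a b 0 = 1 := by
  simp [coefA_eq, coefB_zero]

theorem coefC_zero (a b : ℂ) : coefC a b 0 = 1 := by
  simp [coefC_eq, coefB_zero]

theorem hasDerivAt_cexp_mul_ofReal (a : ℂ) (t : ℝ) :
    HasDerivAt (fun t : ℝ => Complex.exp (a * t)) (a * Complex.exp (a * t)) t := by
  simpa [mul_comm] using ((Complex.ofRealCLM.hasDerivAt (x := t)).const_mul a).cexp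

theorem hasDerivAt_coefB (a b : ℂ) (t : ℝ) : HasDerivAt (coefB a b) (coefC a b t) t := by
  by_cases hab : a = b
  · have hfun : coefB a b = fun t : ℝ => t * Complex.exp (a * t) := by
      ext t
      simp [coefB, hab]
    rw [hfun]
    refine ((Complex.ofRealCLM.hasDerivAt (x := t)).mul
      (hasDerivAt_cexp_mul_ofReal a t)).congr_deriv ?_
    simp only [coefC, hab, if_true, Complex.ofRealCLM_apply, Complex.ofReal_one]
    ring
  · have hfun : coefB a b = fun t : ℝ =>
        (Complex.exp (a * t) - Complex.exp (b * t)) / (a - b) := by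
      ext t
      simp [coefB, hab]
    rw [hfun]
    rw [coefC, if_neg hab]
    exact ((hasDerivAt_cexp_mul_ofReal a t).sub (hasDerivAt_cexp_mul_ofReal b t)).div_const (a - b)

theorem hasDerivAt_coefA (a b : ℂ) (t : ℝ) :
    HasDerivAt (coefA a b) (-(a * b) * coefB a b t) t := by
  rw [show coefA a b = _ from funext (coefA_eq a b)]
  refine ((hasDerivAt_cexp_mul_ofReal b t).sub
    ((hasDerivAt_coefB a b t).const_mul b)).congr_deriv ?_
  rw [coefC_eq]
  ring

theorem hasDerivAt_coefC (a b : ℂ) (t : ℝ) :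
    HasDerivAt (coefC a b) ((a + b) * coefC a b t - a * b * coefB a b t) t := by
  rw [show coefC a b = _ from funext (coefC_eq a b)]
  refine ((hasDerivAt_cexp_mul_ofReal b t).add
    ((hasDerivAt_coefB a b t).const_mul a)).congr_deriv ?_
  rw [coefC_eq]
  ring

theorem coefB_scale (ρ : ℝ) (a b : ℂ) (t : ℝ) :
    ρ * coefB (ρ * a) (ρ * b) t = coefB a b (ρ * t) := by
  rcases eq_or_ne ρ 0 with rfl | hρ
  · simp [coefB_zero]
  have hρ' : (ρ : ℂ) ≠ 0 := Complex.ofReal_ne_zero.2 hρ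
  by_cases hab : a = b
  · simp only [coefB, hab, if_true, Complex.ofReal_mul]
    ring_nf
  · have hab' : ¬ (ρ : ℂ) * a = ρ * b := fun h => hab (mul_left_cancel₀ hρ' h)
    simp only [coefB, hab, hab', if_false, Complex.ofReal_mul, ← mul_sub, ← mul_div_assoc]
    rw [mul_div_mul_left _ _ hρ']
    ring_nf

theorem norm_cexp_mul_le_one {a : ℂ} (ha : a.re ≤ 0) {t : ℝ} (ht : 0 ≤ t) :
    ‖Complex.exp (a * t)‖ ≤ 1 := by
  rw [Complex.norm_exp, Complex.re_mul_ofReal, Real.exp_le_one_iff]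
  exact mul_nonpos_of_nonpos_of_nonneg ha ht

theorem mul_norm_cexp_mul_le {a : ℂ} (ha : a.re < 0) (t : ℝ) :
    t * ‖Complex.exp (a * t)‖ ≤ 1 / -a.re := by
  have hexp : ‖Complex.exp (a * t)‖ = (Real.exp (-a.re * t))⁻¹ := by
    rw [Complex.norm_exp, Complex.re_mul_ofReal, ← Real.exp_neg, neg_mul, neg_neg]
  rw [hexp, ← div_eq_mul_inv, div_le_div_iff₀ (Real.exp_pos _) (neg_pos.2 ha), one_mul]
  linarith [Real.add_one_le_exp (-a.re * t)]

theorem exists_norm_coefB_le {a b : ℂ} (ha : a.re ≤ 0) (hb : b.re ≤ 0) (hab : a = b → a.re < 0) :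
    ∃ C : ℝ, ∀ t : ℝ, 0 ≤ t → ‖coefB a b t‖ ≤ C := by
  rcases eq_or_ne a b with rfl | hne
  · refine ⟨1 / -a.re, fun t ht => ?_⟩
    rw [coefB, if_pos rfl, norm_mul, Complex.norm_real, Real.norm_of_nonneg ht]
    exact mul_norm_cexp_mul_le (hab rfl) t
  · refine ⟨(1 + 1) / ‖a - b‖, fun t ht => ?_⟩
    rw [coefB, if_neg hne, norm_div]
    gcongr
    exact norm_sub_le_of_le (norm_cexp_mul_le_one ha ht) (norm_cexp_mul_le_one hb ht)

theorem exists_norm_coef_scale_le {a b : ℂ} (ha : a.re ≤ 0) (hb : b.re ≤ 0)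
    (hab : a = b → a.re < 0) :
    ∃ C : ℝ, 0 ≤ C ∧ ∀ ρ t : ℝ, 0 ≤ ρ → 0 ≤ t →
      ‖coefA (ρ * a) (ρ * b) t‖ ≤ C ∧ ρ * ‖coefB (ρ * a) (ρ * b) t‖ ≤ C ∧
        ‖coefC (ρ * a) (ρ * b) t‖ ≤ C := by
  obtain ⟨M, hM⟩ := exists_norm_coefB_le ha hb hab
  have hM₀ : 0 ≤ M := (norm_nonneg _).trans (hM 0 le_rfl)
  refine ⟨1 + M + (‖a‖ + ‖b‖) * M, by positivity, fun ρ t hρ ht => ?_⟩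
  have hB : ‖(ρ : ℂ) * coefB (ρ * a) (ρ * b) t‖ ≤ M := by
    rw [coefB_scale]
    exact hM _ (mul_nonneg hρ ht)
  have hmulB (z : ℂ) : ‖(ρ : ℂ) * z * coefB (ρ * a) (ρ * b) t‖ ≤ ‖z‖ * M := by
    rw [mul_comm (ρ : ℂ) z, mul_assoc, norm_mul]
    gcongr
  have hE : ‖Complex.exp (ρ * b * t)‖ ≤ 1 :=
    norm_cexp_mul_le_one (by
      rw [Complex.re_ofReal_mul]
      exact mul_nonpos_of_nonneg_of_nonpos hρ hb) ht
  have haM : 0 ≤ ‖a‖ * M := by positivity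
  have hbM : 0 ≤ ‖b‖ * M := by positivity
  refine ⟨?_, ?_, ?_⟩
  · rw [coefA_eq]
    linarith [norm_sub_le_of_le hE (hmulB b)]
  · rw [norm_mul, Complex.norm_real, Real.norm_of_nonneg hρ] at hB
    linarith
  · rw [coefC_eq]
    linarith [norm_add_le_of_le hE (hmulB a)]

end Coefficients

section Eigenvalues

variable {ν ν' κ : ℝ}

theorem rootK_sq (ν ν' κ : ℝ) : rootK ν ν' κ ^ 2 = ((1 - (2 * √κ / (ν + ν')) ^ 2 : ℝ) : ℂ) := by
  simp [rootK]

theorem abs_re_rootK_le_one (ν ν' κ : ℝ) : |(rootK ν ν' κ).re| ≤ 1 := by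
  have hsq := rootK_sq ν ν' κ
  have hre := congrArg Complex.re hsq
  have him := congrArg Complex.im hsq
  simp only [pow_two, Complex.mul_re, Complex.mul_im, Complex.ofReal_re, Complex.ofReal_im]
    at hre him
  rw [abs_le_one_iff_mul_self_le_one]
  rcases mul_eq_zero.1 (by linarith : (rootK ν ν' κ).re * (rootK ν ν' κ).im = 0) with h | h
  · simp [h]
  · rw [h] at hre
    nlinarith [mul_self_nonneg (2 * √κ / (ν + ν'))]

/-- The value of `λ₊` on the unit sphere, so that `λ₊(ξ) = |ξ|² rateP`. -/
def rateP (ν ν' κ : ℝ) : ℂ := -(((ν + ν') / 2 : ℝ) : ℂ) * (1 + rootK ν ν' κ)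

/-- The value of `λ₋` on the unit sphere, so that `λ₋(ξ) = |ξ|² rateM`. -/
def rateM (ν ν' κ : ℝ) : ℂ := -(((ν + ν') / 2 : ℝ) : ℂ) * (1 - rootK ν ν' κ)

theorem rateP_re_nonpos (hν : 0 ≤ ν + ν') : (rateP ν ν' κ).re ≤ 0 := by
  have h := (abs_le.1 (abs_re_rootK_le_one ν ν' κ)).1
  rw [rateP, ← Complex.ofReal_neg, Complex.re_ofReal_mul, Complex.add_re, Complex.one_re]
  exact mul_nonpos_of_nonpos_of_nonneg (by linarith) (by linarith)

theorem rateM_re_nonpos (hν : 0 ≤ ν + ν') : (rateM ν ν' κ).re ≤ 0 := by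
  have h := (abs_le.1 (abs_re_rootK_le_one ν ν' κ)).2
  rw [rateM, ← Complex.ofReal_neg, Complex.re_ofReal_mul, Complex.sub_re, Complex.one_re]
  exact mul_nonpos_of_nonpos_of_nonneg (by linarith) (by linarith)

theorem rateP_re_neg_of_eq (hν : 0 < ν + ν') (h : rateP ν ν' κ = rateM ν ν' κ) :
    (rateP ν ν' κ).re < 0 := by
  have hc : (-(((ν + ν') / 2 : ℝ) : ℂ)) ≠ 0 :=
    neg_ne_zero.2 (Complex.ofReal_ne_zero.2 (half_pos hν).ne')
  have hroot : rootK ν ν' κ = 0 := by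
    linear_combination (1 / 2 : ℂ) * mul_left_cancel₀ hc h
  rw [rateP, hroot, add_zero, mul_one, Complex.neg_re, Complex.ofReal_re]
  linarith

variable {n : ℕ}

theorem lamP_eq (ξ : Sp n) : lamP ν ν' κ ξ = ((‖ξ‖ ^ 2 : ℝ) : ℂ) * rateP ν ν' κ := by
  rw [lamP, rateP]
  ring

theorem lamM_eq (ξ : Sp n) : lamM ν ν' κ ξ = ((‖ξ‖ ^ 2 : ℝ) : ℂ) * rateM ν ν' κ := by
  rw [lamM, rateM]
  ring

theorem lamP_add_lamM (ξ : Sp n) :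
    lamP ν ν' κ ξ + lamM ν ν' κ ξ = -((ν : ℂ) + ν') * (‖ξ‖ ^ 2 : ℝ) := by
  rw [lamP, lamM]
  push_cast
  ring

theorem lamP_mul_lamM (hν : ν + ν' ≠ 0) (hκ : 0 ≤ κ) (ξ : Sp n) :
    lamP ν ν' κ ξ * lamM ν ν' κ ξ = (κ : ℂ) * ((‖ξ‖ ^ 2 : ℝ) : ℂ) ^ 2 := by
  have hκ_eq : ((ν + ν') / 2) ^ 2 * (2 * √κ / (ν + ν')) ^ 2 = κ := by
    have := Real.sq_sqrt hκ
    field_simp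
    linarith
  have hκ_eq' : (((ν + ν') / 2 : ℝ) : ℂ) ^ 2 * (((2 * √κ / (ν + ν')) ^ 2 : ℝ) : ℂ) = κ := by
    rw [← Complex.ofReal_pow, ← Complex.ofReal_mul, hκ_eq]
  have hroot := rootK_sq ν ν' κ
  rw [Complex.ofReal_sub, Complex.ofReal_one] at hroot
  rw [lamP, lamM]
  linear_combination (-(((ν + ν') / 2 : ℝ) : ℂ) ^ 2 * ((‖ξ‖ ^ 2 : ℝ) : ℂ) ^ 2) * hroot
    + ((‖ξ‖ ^ 2 : ℝ) : ℂ) ^ 2 * hκ_eq'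

theorem exists_norm_coef_lam_le (n : ℕ) (hν : 0 < ν + ν') (κ : ℝ) :
    ∃ C : ℝ, 0 ≤ C ∧ ∀ (ξ : Sp n) (t : ℝ), 0 ≤ t →
      ‖coefA (lamP ν ν' κ ξ) (lamM ν ν' κ ξ) t‖ ≤ C ∧
      ‖ξ‖ ^ 2 * ‖coefB (lamP ν ν' κ ξ) (lamM ν ν' κ ξ) t‖ ≤ C ∧
      ‖coefC (lamP ν ν' κ ξ) (lamM ν ν' κ ξ) t‖ ≤ C := by
  obtain ⟨C, hC₀, hC⟩ := exists_norm_coef_scale_le (rateP_re_nonpos (κ := κ) hν.le)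
    (rateM_re_nonpos hν.le) (rateP_re_neg_of_eq hν)
  refine ⟨C, hC₀, fun ξ t ht => ?_⟩
  simpa only [lamP_eq, lamM_eq] using hC (‖ξ‖ ^ 2) t (sq_nonneg _) ht

end Eigenvalues

section SolutionMatrix

variable {n : ℕ}

/-- The space of values of `(φ̂, m̂)` at a frequency. -/
abbrev Val (n : ℕ) : Type := ℂ × (Fin n → ℂ)

/-- The linear form `m ↦ ξ · m`. -/
def freqDot (ξ : Sp n) : (Fin n → ℂ) →L[ℂ] ℂ := ∑ j, (ξ j : ℂ) • ContinuousLinearMap.proj j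

theorem freqDot_apply (ξ : Sp n) (m : Fin n → ℂ) : freqDot ξ m = ∑ j, (ξ j : ℂ) * m j := by
  simp [freqDot]

theorem freqDot_self (ξ : Sp n) : freqDot ξ (fun j => (ξ j : ℂ)) = ((‖ξ‖ ^ 2 : ℝ) : ℂ) := by
  rw [freqDot_apply, EuclideanSpace.real_norm_sq_eq, Complex.ofReal_sum]
  simp only [sq, Complex.ofReal_mul]

/-- The Fourier symbol of `-A`. -/
def genSymbol (ν ν' κ : ℝ) (ξ : Sp n) : Val n →L[ℂ] Val n :=
  let divg := freqDot ξ ∘L ContinuousLinearMap.snd ℂ ℂ (Fin n → ℂ)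
  (-Complex.I • divg).prod (ContinuousLinearMap.pi fun i =>
    (-Complex.I * κ * (‖ξ‖ ^ 2 : ℝ) * ξ i) • ContinuousLinearMap.fst ℂ ℂ (Fin n → ℂ)
      - (ν * (‖ξ‖ ^ 2 : ℝ) : ℂ) •
        (ContinuousLinearMap.proj i ∘L ContinuousLinearMap.snd ℂ ℂ (Fin n → ℂ))
      - (ν' * ξ i : ℂ) • divg)

theorem genSymbol_apply (ν ν' κ : ℝ) (ξ : Sp n) (v : Val n) :
    genSymbol ν ν' κ ξ v = (-Complex.I * freqDot ξ v.2, fun i =>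
      -Complex.I * κ * (‖ξ‖ ^ 2 : ℝ) * ξ i * v.1 - ν * (‖ξ‖ ^ 2 : ℝ) * v.2 i
        - ν' * ξ i * freqDot ξ v.2) := rfl

/-- The product of the solution matrix at time `t` and frequency `ξ` with the vector `v`. -/
def solVec (ν ν' κ : ℝ) (ξ : Sp n) (v : Val n) (t : ℝ) : Val n :=
  (S11 ν ν' κ t ξ * v.1 + ∑ j, S12 ν ν' κ t ξ j * v.2 j, fun i =>
    S21 ν ν' κ t ξ i * v.1 + ∑ j, S22 ν ν' κ t ξ i j * v.2 j)

variable {ν ν' κ : ℝ}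

theorem solVec_fst (ξ : Sp n) (v : Val n) (t : ℝ) :
    (solVec ν ν' κ ξ v t).1 = coefA (lamP ν ν' κ ξ) (lamM ν ν' κ ξ) t * v.1
      - Complex.I * coefB (lamP ν ν' κ ξ) (lamM ν ν' κ ξ) t * freqDot ξ v.2 := by
  simp only [solVec, S11, S12, freqDot_apply, sub_eq_add_neg, Finset.mul_sum]
  rw [← Finset.sum_neg_distrib]
  congr 1
  exact Finset.sum_congr rfl fun j _ => by ring

theorem solVec_snd (ξ : Sp n) (v : Val n) (t : ℝ) :
    (solVec ν ν' κ ξ v t).2 =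
      (-Complex.I * κ * (‖ξ‖ ^ 2 : ℝ) * v.1 * coefB (lamP ν ν' κ ξ) (lamM ν ν' κ ξ) t
        + (coefC (lamP ν ν' κ ξ) (lamM ν ν' κ ξ) t - Complex.exp (-(ν * ‖ξ‖ ^ 2 : ℝ) * t))
          * (freqDot ξ v.2 / (‖ξ‖ ^ 2 : ℝ))) • (fun j => (ξ j : ℂ))
      + Complex.exp (-(ν * ‖ξ‖ ^ 2 : ℝ) * t) • v.2 := by
  ext i
  have hexponent : (-(ν * ‖ξ‖ ^ 2 * t : ℝ) : ℂ) = -(ν * ‖ξ‖ ^ 2 : ℝ) * t := by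
    push_cast
    ring
  have hrow (c d : ℂ) :
      ∑ j, (d * (if i = j then 1 else 0) + c * (ξ i * ξ j / (‖ξ‖ ^ 2 : ℝ))) * v.2 j
      = d * v.2 i + c * (ξ i * (freqDot ξ v.2 / (‖ξ‖ ^ 2 : ℝ))) := by
    simp only [add_mul, Finset.sum_add_distrib, freqDot_apply, Finset.sum_div, Finset.mul_sum]
    congr 1
    · simp
    · exact Finset.sum_congr rfl fun j _ => by ring
  simp only [solVec, S21, S22, hexponent, hrow, Pi.add_apply, Pi.smul_apply, smul_eq_mul]
  ring

theorem solVec_zero (ξ : Sp n) (v : Val n) : solVec ν ν' κ ξ v 0 = v := by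
  refine Prod.ext ?_ ?_
  · simp [solVec_fst, coefA_zero, coefB_zero]
  · simp [solVec_snd, coefB_zero, coefC_zero]

theorem freqDot_solVec_snd {ξ : Sp n} (hξ : ξ ≠ 0) (v : Val n) (t : ℝ) :
    freqDot ξ (solVec ν ν' κ ξ v t).2 =
      -Complex.I * κ * ((‖ξ‖ ^ 2 : ℝ) : ℂ) ^ 2 * v.1 * coefB (lamP ν ν' κ ξ) (lamM ν ν' κ ξ) t
        + coefC (lamP ν ν' κ ξ) (lamM ν ν' κ ξ) t * freqDot ξ v.2 := by
  have hρ : ((‖ξ‖ ^ 2 : ℝ) : ℂ) ≠ 0 :=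
    Complex.ofReal_ne_zero.2 (pow_ne_zero 2 (norm_ne_zero_iff.2 hξ))
  rw [solVec_snd, map_add, map_smul, map_smul, freqDot_self, smul_eq_mul, smul_eq_mul]
  linear_combination (coefC (lamP ν ν' κ ξ) (lamM ν ν' κ ξ) t
    - Complex.exp (-(ν * ‖ξ‖ ^ 2 : ℝ) * t)) * div_mul_cancel₀ (freqDot ξ v.2) hρ

theorem hasDerivAt_solVec_fst (hν : ν + ν' ≠ 0) (hκ : 0 ≤ κ) {ξ : Sp n} (hξ : ξ ≠ 0) (v : Val n)
    (t : ℝ) :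
    HasDerivAt (fun t => (solVec ν ν' κ ξ v t).1) (genSymbol ν ν' κ ξ (solVec ν ν' κ ξ v t)).1
      t := by
  simp only [solVec_fst, genSymbol_apply, freqDot_solVec_snd hξ]
  refine (((hasDerivAt_coefA _ _ t).mul_const _).sub
    (((hasDerivAt_coefB _ _ t).const_mul _).mul_const _)).congr_deriv ?_
  rw [lamP_mul_lamM hν hκ]
  linear_combination (-(κ : ℂ) * ((‖ξ‖ ^ 2 : ℝ) : ℂ) ^ 2 * v.1 *
    coefB (lamP ν ν' κ ξ) (lamM ν ν' κ ξ) t) * Complex.I_sq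

theorem hasDerivAt_solVec_snd (hν : ν + ν' ≠ 0) (hκ : 0 ≤ κ) {ξ : Sp n} (hξ : ξ ≠ 0) (v : Val n)
    (t : ℝ) (i : Fin n) :
    HasDerivAt (fun t => (solVec ν ν' κ ξ v t).2 i)
      ((genSymbol ν ν' κ ξ (solVec ν ν' κ ξ v t)).2 i) t := by
  have hρ : ((‖ξ‖ ^ 2 : ℝ) : ℂ) ≠ 0 :=
    Complex.ofReal_ne_zero.2 (pow_ne_zero 2 (norm_ne_zero_iff.2 hξ))
  have hE := hasDerivAt_cexp_mul_ofReal (-(ν * ‖ξ‖ ^ 2 : ℝ)) t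
  have hC := hasDerivAt_coefC (lamP ν ν' κ ξ) (lamM ν ν' κ ξ) t
  have hdiv := mul_div_cancel₀ (freqDot ξ v.2) hρ
  have hCA : coefC (lamP ν ν' κ ξ) (lamM ν ν' κ ξ) t = coefA (lamP ν ν' κ ξ) (lamM ν ν' κ ξ) t
      + (lamP ν ν' κ ξ + lamM ν ν' κ ξ) * coefB (lamP ν ν' κ ξ) (lamM ν ν' κ ξ) t := by
    linear_combination coefC_eq (lamP ν ν' κ ξ) (lamM ν ν' κ ξ) t
      - coefA_eq (lamP ν ν' κ ξ) (lamM ν ν' κ ξ) t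
  simp only [genSymbol_apply, freqDot_solVec_snd hξ]
  simp only [solVec_snd, solVec_fst, Pi.add_apply, Pi.smul_apply, smul_eq_mul]
  refine (((((hasDerivAt_coefB _ _ t).const_mul _).add ((hC.sub hE).mul_const _)).mul_const _).add
    (hE.mul_const _)).congr_deriv ?_
  rw [hCA, lamP_add_lamM, lamP_mul_lamM hν hκ]
  generalize coefA (lamP ν ν' κ ξ) (lamM ν ν' κ ξ) t = a
  generalize coefB (lamP ν ν' κ ξ) (lamM ν ν' κ ξ) t = b
  generalize freqDot ξ v.2 = d at *
  push_cast at *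
  linear_combination
    (-ν' * (a - (ν + ν') * (‖ξ‖ : ℂ) ^ 2 * b) - κ * (‖ξ‖ : ℂ) ^ 2 * b) * ξ i * hdiv
      - κ * (‖ξ‖ : ℂ) ^ 2 * b * d * ξ i * Complex.I_sq

theorem hasDerivAt_solVec (hν : ν + ν' ≠ 0) (hκ : 0 ≤ κ) {ξ : Sp n} (hξ : ξ ≠ 0) (v : Val n)
    (t : ℝ) : HasDerivAt (solVec ν ν' κ ξ v) (genSymbol ν ν' κ ξ (solVec ν ν' κ ξ v t)) t :=
  (hasDerivAt_solVec_fst hν hκ hξ v t).prodMk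
    (hasDerivAt_pi.2 fun i => hasDerivAt_solVec_snd hν hκ hξ v t i)

end SolutionMatrix

section Weights

variable {n : ℕ}

/-- The monomial `|ξ^α|²`. -/
def monoSq (α : Fin n → ℕ) (ξ : Sp n) : ℝ := ∏ j, (ξ j ^ 2) ^ α j

theorem monoSq_nonneg (α : Fin n → ℕ) (ξ : Sp n) : 0 ≤ monoSq α ξ :=
  Finset.prod_nonneg fun _ _ => pow_nonneg (sq_nonneg _) _

theorem monoSq_zero (ξ : Sp n) : monoSq 0 ξ = 1 := by simp [monoSq]

theorem monoSq_add_single (α : Fin n → ℕ) (j : Fin n) (ξ : Sp n) :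
    monoSq (α + Pi.single j 1) ξ = ξ j ^ 2 * monoSq α ξ := by
  have hsingle : monoSq (Pi.single j 1) ξ = ξ j ^ 2 := by
    rw [monoSq, Finset.prod_eq_single j (fun i _ hij => by simp [hij]) (by simp)]
    simp
  simp only [monoSq, Pi.add_apply, pow_add, Finset.prod_mul_distrib] at hsingle ⊢
  rw [hsingle, mul_comm]

theorem sum_add_single_one (α : Fin n → ℕ) (j : Fin n) :
    ∑ i, (α + Pi.single j 1 : Fin n → ℕ) i = ∑ i, α i + 1 := by
  simp [Finset.sum_add_distrib]

/-- The squared Sobolev weight `∑_{|α| ≤ k} |ξ^α|²`. -/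
def weightSq (k : ℕ) (ξ : Sp n) : ℝ := ∑ α : MultiIndex n k, monoSq (fun i => (α.1 i : ℕ)) ξ

theorem monoSq_le_weightSq {k : ℕ} {α : Fin n → ℕ} (hα : ∑ i, α i ≤ k) (ξ : Sp n) :
    monoSq α ξ ≤ weightSq k ξ := by
  have hα_lt (i : Fin n) : α i < k + 1 := Nat.lt_succ_of_le
    ((Finset.single_le_sum (fun _ _ => Nat.zero_le _) (Finset.mem_univ i)).trans hα)
  exact Finset.single_le_sum (f := fun β : MultiIndex n k => monoSq (fun i => (β.1 i : ℕ)) ξ)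
    (fun β _ => monoSq_nonneg _ ξ)
    (Finset.mem_univ (⟨fun i => ⟨α i, hα_lt i⟩, hα⟩ : MultiIndex n k))

theorem one_le_weightSq (k : ℕ) (ξ : Sp n) : 1 ≤ weightSq k ξ :=
  (monoSq_zero ξ).symm.trans_le (monoSq_le_weightSq (by simp) ξ)

theorem norm_sq_mul_monoSq_le {k : ℕ} {α : Fin n → ℕ} (hα : ∑ i, α i ≤ k) (ξ : Sp n) :
    ‖ξ‖ ^ 2 * monoSq α ξ ≤ n * weightSq (k + 1) ξ := by
  have hterm (j : Fin n) : ξ j ^ 2 * monoSq α ξ ≤ weightSq (k + 1) ξ := by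
    rw [← monoSq_add_single]
    exact monoSq_le_weightSq ((sum_add_single_one α j).trans_le (Nat.succ_le_succ hα)) ξ
  rw [EuclideanSpace.real_norm_sq_eq, Finset.sum_mul]
  simpa using Finset.sum_le_card_nsmul Finset.univ _ _ fun j _ => hterm j

theorem norm_sq_mul_weightSq_le (k : ℕ) (ξ : Sp n) :
    ‖ξ‖ ^ 2 * weightSq k ξ ≤ (Fintype.card (MultiIndex n k) * n : ℝ) * weightSq (k + 1) ξ := by
  rw [weightSq, Finset.mul_sum]
  simpa [mul_assoc] using
    Finset.sum_le_card_nsmul Finset.univ _ _ fun α _ => norm_sq_mul_monoSq_le α.2 ξ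

theorem monoSq_le_norm_sq_mul_weightSq {k : ℕ} {β : Fin n → ℕ} (hβ : ∑ i, β i ≤ k + 1)
    (hβ₀ : β ≠ 0) (ξ : Sp n) : monoSq β ξ ≤ ‖ξ‖ ^ 2 * weightSq k ξ := by
  obtain ⟨j, hj⟩ := Function.ne_iff.1 hβ₀
  have hj_le : Pi.single j 1 ≤ β := by
    rw [Pi.le_def]
    intro i
    obtain rfl | hij := eq_or_ne i j
    · simpa using Nat.one_le_iff_ne_zero.2 hj
    · simp [hij]
  obtain ⟨α, rfl⟩ : ∃ α : Fin n → ℕ, β = α + Pi.single j 1 :=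
    ⟨_, (tsub_add_cancel_of_le hj_le).symm⟩
  rw [sum_add_single_one] at hβ
  have hcoord : ξ j ^ 2 ≤ ‖ξ‖ ^ 2 := sq_le_sq.2 (by simpa using PiLp.norm_apply_le ξ j)
  rw [monoSq_add_single]
  exact mul_le_mul hcoord (monoSq_le_weightSq (Nat.le_of_succ_le_succ hβ) ξ) (monoSq_nonneg _ _)
    (sq_nonneg _)

theorem monoSq_le_of_le_norm {k : ℕ} {β : Fin n → ℕ} (hβ : ∑ i, β i ≤ k + 1) {r : ℝ} (hr : 0 < r)
    {ξ : Sp n} (hξ : r ≤ ‖ξ‖) : monoSq β ξ ≤ (1 + 1 / r ^ 2) * (‖ξ‖ ^ 2 * weightSq k ξ) := by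
  have hw := one_le_weightSq k ξ
  obtain rfl | hβ₀ := eq_or_ne β 0
  · have hone : 1 ≤ 1 / r ^ 2 * ‖ξ‖ ^ 2 := by
      rw [one_div_mul_eq_div, one_le_div (by positivity)]
      gcongr
    calc monoSq 0 ξ = 1 := monoSq_zero ξ
      _ ≤ 1 / r ^ 2 * ‖ξ‖ ^ 2 * weightSq k ξ := one_le_mul_of_one_le_of_one_le hone hw
      _ = 1 / r ^ 2 * (‖ξ‖ ^ 2 * weightSq k ξ) := mul_assoc _ _ _
      _ ≤ (1 + 1 / r ^ 2) * (‖ξ‖ ^ 2 * weightSq k ξ) := by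
        gcongr
        linarith
  · exact (monoSq_le_norm_sq_mul_weightSq hβ hβ₀ ξ).trans
      (le_mul_of_one_le_left (by positivity) (le_add_of_nonneg_right (by positivity)))

theorem weightSq_succ_le (k : ℕ) {r : ℝ} (hr : 0 < r) {ξ : Sp n} (hξ : r ≤ ‖ξ‖) :
    weightSq (k + 1) ξ ≤
      (Fintype.card (MultiIndex n (k + 1)) * (1 + 1 / r ^ 2)) * (‖ξ‖ ^ 2 * weightSq k ξ) := by
  rw [weightSq]
  simpa [mul_assoc] using
    Finset.sum_le_card_nsmul Finset.univ _ _ fun β _ => monoSq_le_of_le_norm β.2 hr hξ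

/-- The Sobolev weight `(∑_{|α| ≤ k} |ξ^α|²)^{1/2}`. -/
def weight (k : ℕ) (ξ : Sp n) : ℝ := √(weightSq k ξ)

theorem weight_pos (k : ℕ) (ξ : Sp n) : 0 < weight k ξ :=
  Real.sqrt_pos.2 (one_pos.trans_le (one_le_weightSq k ξ))

theorem weight_sq (k : ℕ) (ξ : Sp n) : weight k ξ ^ 2 = weightSq k ξ :=
  Real.sq_sqrt (one_pos.trans_le (one_le_weightSq k ξ)).le

theorem continuous_weight (k : ℕ) : Continuous (weight k : Sp n → ℝ) := by
  unfold weight weightSq monoSq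
  fun_prop

theorem exists_weight_comparison (n k : ℕ) {r : ℝ} (hr : 0 < r) :
    ∃ c : ℝ, 0 ≤ c ∧ ∀ ξ : Sp n, r ≤ ‖ξ‖ →
      weight (k + 1) ξ ≤ c * (‖ξ‖ * weight k ξ) ∧ ‖ξ‖ * weight k ξ ≤ c * weight (k + 1) ξ := by
  set a : ℝ := Fintype.card (MultiIndex n k) * n
  set b : ℝ := Fintype.card (MultiIndex n (k + 1)) * (1 + 1 / r ^ 2)
  have ha : 0 ≤ a := by positivity
  have hb : 0 ≤ b := by positivity
  refine ⟨√(a + b), Real.sqrt_nonneg _, fun ξ hξ => ?_⟩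
  have hwk := weight_pos k ξ
  have hwk1 := weight_pos (k + 1) ξ
  constructor
  · refine (sq_le_sq₀ hwk1.le (by positivity)).1 ?_
    rw [mul_pow, mul_pow, Real.sq_sqrt (by positivity)]
    calc weight (k + 1) ξ ^ 2 = weightSq (k + 1) ξ := weight_sq _ _
      _ ≤ b * (‖ξ‖ ^ 2 * weight k ξ ^ 2) := weight_sq k ξ ▸ weightSq_succ_le k hr hξ
      _ ≤ (a + b) * (‖ξ‖ ^ 2 * weight k ξ ^ 2) := by
        gcongr
        exact le_add_of_nonneg_left ha
  · refine (sq_le_sq₀ (by positivity) (by positivity)).1 ?_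
    rw [mul_pow, mul_pow, Real.sq_sqrt (by positivity)]
    calc ‖ξ‖ ^ 2 * weight k ξ ^ 2 = ‖ξ‖ ^ 2 * weightSq k ξ := by rw [weight_sq]
      _ ≤ a * weight (k + 1) ξ ^ 2 := weight_sq (k + 1) ξ ▸ norm_sq_mul_weightSq_le k ξ
      _ ≤ (a + b) * weight (k + 1) ξ ^ 2 := by
        gcongr
        exact le_add_of_nonneg_right hb

end Weights

section Stability

variable {n : ℕ}

theorem ofReal_weight_ne_zero (k : ℕ) (ξ : Sp n) : (weight k ξ : ℂ) ≠ 0 :=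
  Complex.ofReal_ne_zero.2 (weight_pos k ξ).ne'

/-- The Sobolev weight as a unit of `ℂ`, acting on frequency components by scaling. -/
def weightUnit (k : ℕ) (ξ : Sp n) : ℂˣ := Units.mk0 (weight k ξ : ℂ) (ofReal_weight_ne_zero k ξ)

/-- Multiplication of `(φ̂, m̂)` by the weights of `H^{k+1}` and `H^k` respectively. -/
def weightEquiv (k : ℕ) (ξ : Sp n) : Val n ≃L[ℂ] Val n :=
  (ContinuousLinearEquiv.smulLeft (weightUnit (k + 1) ξ)).prodCongr
    (ContinuousLinearEquiv.smulLeft (weightUnit k ξ))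

theorem weightEquiv_apply (k : ℕ) (ξ : Sp n) (v : Val n) :
    weightEquiv k ξ v = ((weight (k + 1) ξ : ℂ) * v.1, (weight k ξ : ℂ) • v.2) := rfl

theorem weightEquiv_symm_apply (k : ℕ) (ξ : Sp n) (v : Val n) :
    (weightEquiv k ξ).symm v = ((weight (k + 1) ξ : ℂ)⁻¹ * v.1, (weight k ξ : ℂ)⁻¹ • v.2) := by
  rw [ContinuousLinearEquiv.symm_apply_eq, weightEquiv_apply]
  simp only [mul_inv_cancel_left₀ (ofReal_weight_ne_zero _ ξ),
    smul_inv_smul₀ (ofReal_weight_ne_zero _ ξ)]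

/-- The symbol of `-A` acting on the weighted variables. -/
def weightedSymbol (ν ν' κ : ℝ) (k : ℕ) (ξ : Sp n) : Val n →L[ℂ] Val n :=
  (weightEquiv k ξ : Val n →L[ℂ] Val n) ∘L genSymbol ν ν' κ ξ ∘L
    ((weightEquiv k ξ).symm : Val n →L[ℂ] Val n)

variable {ν ν' κ : ℝ}

theorem weightedSymbol_weightEquiv (k : ℕ) (ξ : Sp n) (v : Val n) :
    weightedSymbol ν ν' κ k ξ (weightEquiv k ξ v) = weightEquiv k ξ (genSymbol ν ν' κ ξ v) := by
  simp [weightedSymbol]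

theorem continuous_weightedSymbol (k : ℕ) :
    Continuous fun ξ : Sp n => weightedSymbol ν ν' κ k ξ := by
  rw [continuous_clm_apply]
  intro v
  have hw (l : ℕ) : Continuous fun ξ : Sp n => (weight l ξ : ℂ) :=
    Complex.continuous_ofReal.comp (continuous_weight l)
  have hw_inv (l : ℕ) : Continuous fun ξ : Sp n => (weight l ξ : ℂ)⁻¹ :=
    (hw l).inv₀ (ofReal_weight_ne_zero l)
  simp only [weightedSymbol, ContinuousLinearMap.comp_apply, ContinuousLinearEquiv.coe_coe,
    weightEquiv_apply, weightEquiv_symm_apply, genSymbol_apply, freqDot_apply, Pi.smul_apply]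
  fun_prop

theorem exp_weightedSymbol_weightEquiv (hν : ν + ν' ≠ 0) (hκ : 0 ≤ κ) (k : ℕ) {ξ : Sp n}
    (hξ : ξ ≠ 0) (v : Val n) (t : ℝ) :
    NormedSpace.exp (t • weightedSymbol ν ν' κ k ξ) (weightEquiv k ξ v) =
      weightEquiv k ξ (solVec ν ν' κ ξ v t) := by
  have hderiv (t : ℝ) : HasDerivAt (fun t => weightEquiv k ξ (solVec ν ν' κ ξ v t))
      (weightedSymbol ν ν' κ k ξ (weightEquiv k ξ (solVec ν ν' κ ξ v t))) t := by
    rw [weightedSymbol_weightEquiv]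
    exact ((weightEquiv k ξ : Val n →L[ℂ] Val n).restrictScalars
      ℝ).hasFDerivAt.comp_hasDerivAt t (hasDerivAt_solVec hν hκ hξ v t)
  have hexp := eq_clm_exp_of_hasDerivAt hderiv t
  rw [solVec_zero] at hexp
  exact hexp.symm

theorem norm_ofReal_apply_le (ξ : Sp n) (j : Fin n) : ‖(ξ j : ℂ)‖ ≤ ‖ξ‖ :=
  (Complex.norm_real _).trans_le (PiLp.norm_apply_le ξ j)

theorem norm_S12_le (ξ : Sp n) (t : ℝ) (j : Fin n) :
    ‖S12 ν ν' κ t ξ j‖ ≤ ‖coefB (lamP ν ν' κ ξ) (lamM ν ν' κ ξ) t‖ * ‖ξ‖ := by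
  simp only [S12, norm_mul, norm_neg, Complex.norm_I, one_mul]
  gcongr
  exact norm_ofReal_apply_le ξ j

theorem norm_S21_le (hκ : 0 ≤ κ) (ξ : Sp n) (t : ℝ) (i : Fin n) :
    ‖S21 ν ν' κ t ξ i‖ ≤
      κ * ‖ξ‖ * (‖ξ‖ ^ 2 * ‖coefB (lamP ν ν' κ ξ) (lamM ν ν' κ ξ) t‖) := by
  simp only [S21, norm_mul, norm_neg, Complex.norm_I, one_mul]
  rw [Complex.norm_of_nonneg hκ, Complex.norm_of_nonneg (sq_nonneg _), mul_comm κ,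
    mul_assoc _ _ ‖_‖]
  gcongr
  exact norm_ofReal_apply_le ξ i

theorem norm_S22_le (hν : 0 ≤ ν) (ξ : Sp n) {t : ℝ} (ht : 0 ≤ t) (i j : Fin n) :
    ‖S22 ν ν' κ t ξ i j‖ ≤ 2 + ‖coefC (lamP ν ν' κ ξ) (lamM ν ν' κ ξ) t‖ := by
  have hexp : ‖Complex.exp (-(ν * ‖ξ‖ ^ 2 * t : ℝ))‖ ≤ 1 := by
    rw [← Complex.ofReal_neg, Complex.norm_exp_ofReal, Real.exp_le_one_iff, neg_nonpos]
    positivity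
  have hdelta : ‖(if i = j then 1 else 0 : ℂ)‖ ≤ 1 := by split_ifs <;> simp
  have hproj : ‖(ξ i : ℂ) * ξ j / (‖ξ‖ ^ 2 : ℝ)‖ ≤ 1 := by
    rw [norm_div, norm_mul, Complex.norm_of_nonneg (sq_nonneg _), sq]
    exact div_le_one_of_le₀ (mul_le_mul (norm_ofReal_apply_le ξ i) (norm_ofReal_apply_le ξ j)
      (norm_nonneg _) (norm_nonneg _)) (by positivity)
  set E := Complex.exp (-(ν * ‖ξ‖ ^ 2 * t : ℝ))
  set c := coefC (lamP ν ν' κ ξ) (lamM ν ν' κ ξ) t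
  calc ‖S22 ν ν' κ t ξ i j‖
      ≤ ‖E‖ * ‖(if i = j then 1 else 0 : ℂ)‖ + ‖c - E‖ * ‖(ξ i : ℂ) * ξ j / (‖ξ‖ ^ 2 : ℝ)‖ := by
        rw [← norm_mul, ← norm_mul]
        exact norm_add_le _ _
    _ ≤ 1 * 1 + (‖c‖ + ‖E‖) * 1 := by
        gcongr
        exact norm_sub_le _ _
    _ ≤ 2 + ‖c‖ := by linarith

/-- For `S₁₂` and `S₂₁` the quotient of the weights absorbs an unbounded power of `|ξ|`. -/
theorem exists_weighted_entry_bound (n k : ℕ) (hν : 0 ≤ ν) (hνν' : 0 < ν + ν') (hκ : 0 ≤ κ)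
    {r : ℝ} (hr : 0 < r) :
    ∃ K : ℝ, 0 ≤ K ∧ ∀ (ξ : Sp n) (t : ℝ), r ≤ ‖ξ‖ → 0 ≤ t →
      weight (k + 1) ξ * ‖S11 ν ν' κ t ξ‖ ≤ K * weight (k + 1) ξ ∧
      (∀ j, weight (k + 1) ξ * ‖S12 ν ν' κ t ξ j‖ ≤ K * weight k ξ) ∧
      (∀ i, weight k ξ * ‖S21 ν ν' κ t ξ i‖ ≤ K * weight (k + 1) ξ) ∧
      ∀ i j, weight k ξ * ‖S22 ν ν' κ t ξ i j‖ ≤ K * weight k ξ := by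
  obtain ⟨c, hc₀, hc⟩ := exists_weight_comparison n k hr
  obtain ⟨B, hB₀, hB⟩ := exists_norm_coef_lam_le (ν := ν) (ν' := ν') n hνν' κ
  have hκcB : 0 ≤ κ * (c * B) := by positivity
  have hcB : 0 ≤ c * B := by positivity
  refine ⟨B + c * B + κ * (c * B) + (2 + B), by positivity, fun ξ t hξ ht => ?_⟩
  obtain ⟨hA, hBξ, hC⟩ := hB ξ t ht
  obtain ⟨hw₁, hw₂⟩ := hc ξ hξ
  have hp := weight_pos (k + 1) ξ
  have hq := weight_pos k ξ
  set p := weight (k + 1) ξ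
  set q := weight k ξ
  set b := ‖coefB (lamP ν ν' κ ξ) (lamM ν ν' κ ξ) t‖
  refine ⟨?_, fun j => ?_, fun i => ?_, fun i j => ?_⟩
  · calc p * ‖S11 ν ν' κ t ξ‖ ≤ p * B := by gcongr; exact hA
      _ = B * p := mul_comm _ _
      _ ≤ _ := mul_le_mul_of_nonneg_right (by linarith) hp.le
  · calc p * ‖S12 ν ν' κ t ξ j‖ ≤ (c * (‖ξ‖ * q)) * (b * ‖ξ‖) := by
          gcongr
          exact norm_S12_le ξ t j
      _ = c * (‖ξ‖ ^ 2 * b) * q := by ring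
      _ ≤ c * B * q := by gcongr
      _ ≤ _ := mul_le_mul_of_nonneg_right (by linarith) hq.le
  · calc q * ‖S21 ν ν' κ t ξ i‖ ≤ q * (κ * ‖ξ‖ * (‖ξ‖ ^ 2 * b)) := by
          gcongr
          exact norm_S21_le hκ ξ t i
      _ = κ * (‖ξ‖ * q) * (‖ξ‖ ^ 2 * b) := by ring
      _ ≤ κ * (c * p) * B := by gcongr
      _ = κ * (c * B) * p := by ring
      _ ≤ _ := mul_le_mul_of_nonneg_right (by linarith) hp.le
  · calc q * ‖S22 ν ν' κ t ξ i j‖ ≤ q * (2 + B) := by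
          gcongr
          exact (norm_S22_le hν ξ ht i j).trans (by gcongr)
      _ = (2 + B) * q := mul_comm _ _
      _ ≤ _ := mul_le_mul_of_nonneg_right (by linarith) hq.le

theorem mul_norm_mul_le {p q K N : ℝ} {a x : ℂ} (hK : 0 ≤ K) (ha : p * ‖a‖ ≤ K * q)
    (hx : q * ‖x‖ ≤ N) : p * ‖a * x‖ ≤ K * N :=
  calc p * ‖a * x‖ = p * ‖a‖ * ‖x‖ := by rw [norm_mul, mul_assoc]
    _ ≤ K * q * ‖x‖ := by gcongr
    _ = K * (q * ‖x‖) := mul_assoc _ _ _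
    _ ≤ K * N := by gcongr

theorem mul_norm_mul_add_sum_le {ι : Type*} [Fintype ι] {p q₁ q₂ K N : ℝ} {a x : ℂ} {b y : ι → ℂ}
    (hp : 0 ≤ p) (hK : 0 ≤ K) (ha : p * ‖a‖ ≤ K * q₁) (hb : ∀ j, p * ‖b j‖ ≤ K * q₂)
    (hx : q₁ * ‖x‖ ≤ N) (hy : ∀ j, q₂ * ‖y j‖ ≤ N) :
    p * ‖a * x + ∑ j, b j * y j‖ ≤ (1 + Fintype.card ι) * K * N :=
  calc p * ‖a * x + ∑ j, b j * y j‖ ≤ p * (‖a * x‖ + ∑ j, ‖b j * y j‖) := by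
        gcongr
        exact (norm_add_le _ _).trans (add_le_add_right (norm_sum_le _ _) _)
    _ = p * ‖a * x‖ + ∑ j, p * ‖b j * y j‖ := by rw [mul_add, Finset.mul_sum]
    _ ≤ K * N + ∑ _j : ι, K * N := add_le_add (mul_norm_mul_le hK ha hx)
        (Finset.sum_le_sum fun j _ => mul_norm_mul_le hK (hb j) (hy j))
    _ = (1 + Fintype.card ι) * K * N := by
        rw [Finset.sum_const, Finset.card_univ, nsmul_eq_mul]
        ring

theorem norm_weightEquiv_le_iff {k : ℕ} {ξ : Sp n} {v : Val n} {N : ℝ} :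
    ‖weightEquiv k ξ v‖ ≤ N ↔
      weight (k + 1) ξ * ‖v.1‖ ≤ N ∧ ∀ j, weight k ξ * ‖v.2 j‖ ≤ N := by
  have hnorm (l : ℕ) (z : ℂ) : ‖(weight l ξ : ℂ) * z‖ = weight l ξ * ‖z‖ := by
    rw [norm_mul, Complex.norm_of_nonneg (weight_pos l ξ).le]
  rw [norm_prod_le_iff, weightEquiv_apply, hnorm]
  refine and_congr_right fun hN => ?_
  have hN₀ : 0 ≤ N := (mul_nonneg (weight_pos _ _).le (norm_nonneg _)).trans hN
  simp only [pi_norm_le_iff_of_nonneg hN₀, Pi.smul_apply, smul_eq_mul, hnorm]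

theorem exists_norm_solVec_le (n k : ℕ) (hν : 0 ≤ ν) (hνν' : 0 < ν + ν') (hκ : 0 ≤ κ) {r : ℝ}
    (hr : 0 < r) :
    ∃ C : ℝ, 0 ≤ C ∧ ∀ (ξ : Sp n) (t : ℝ) (v : Val n), r ≤ ‖ξ‖ → 0 ≤ t →
      ‖weightEquiv k ξ (solVec ν ν' κ ξ v t)‖ ≤ C * ‖weightEquiv k ξ v‖ := by
  obtain ⟨K, hK₀, hK⟩ := exists_weighted_entry_bound n k hν hνν' hκ hr
  refine ⟨(1 + Fintype.card (Fin n)) * K, by positivity, fun ξ t v hξ ht => ?_⟩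
  obtain ⟨h₁₁, h₁₂, h₂₁, h₂₂⟩ := hK ξ t hξ ht
  obtain ⟨hv₁, hv₂⟩ := norm_weightEquiv_le_iff.1 (le_refl ‖weightEquiv k ξ v‖)
  exact norm_weightEquiv_le_iff.2
    ⟨mul_norm_mul_add_sum_le (weight_pos _ _).le hK₀ h₁₁ h₁₂ hv₁ hv₂,
      fun i => mul_norm_mul_add_sum_le (weight_pos _ _).le hK₀ (h₂₁ i) (h₂₂ i) hv₁ hv₂⟩

theorem exists_norm_exp_weightedSymbol_le (n k : ℕ) (hν : 0 ≤ ν) (hνν' : 0 < ν + ν') (hκ : 0 ≤ κ)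
    {r : ℝ} (hr : 0 < r) :
    ∃ C : ℝ, ∀ (ξ : Sp n), r ≤ ‖ξ‖ → ∀ t : ℝ, 0 ≤ t →
      ‖NormedSpace.exp (t • weightedSymbol ν ν' κ k ξ)‖ ≤ C := by
  obtain ⟨C, hC₀, hC⟩ := exists_norm_solVec_le n k hν hνν' hκ hr
  refine ⟨C, fun ξ hξ t ht => ContinuousLinearMap.opNorm_le_bound _ hC₀ fun v => ?_⟩
  have hξ₀ : ξ ≠ 0 := norm_pos_iff.1 (hr.trans_le hξ)
  obtain ⟨u, rfl⟩ := (weightEquiv k ξ).surjective v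
  rw [exp_weightedSymbol_weightEquiv hνν'.ne' hκ k hξ₀]
  exact hC ξ t u hξ ht

end Stability

section SobolevEquiv

variable {n k : ℕ} {r : ℝ}

/-- Multiplication by an essentially bounded function, as an operator on `Lp`. -/
def linftyMul {Ω : Type*} [MeasurableSpace Ω] {μ : Measure Ω} (p : ℝ≥0∞) [Fact (1 ≤ p)]
    (m : Lp ℂ ∞ μ) : Lp ℂ p μ →L[ℂ] Lp ℂ p μ :=
  (ContinuousLinearMap.mul ℂ ℂ).holderL μ ∞ p p m

theorem coeFn_linftyMul {Ω : Type*} [MeasurableSpace Ω] {μ : Measure Ω} {p : ℝ≥0∞} [Fact (1 ≤ p)]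
    (m : Lp ℂ ∞ μ) (f : Lp ℂ p μ) : linftyMul p m f =ᵐ[μ] fun x => m x * f x :=
  (ContinuousLinearMap.mul ℂ ℂ).coeFn_holder m f

/-- The frequencies `η` with `|2πη| ≥ r`. -/
def highSet (n : ℕ) (r : ℝ) : Set (Sp n) := {η | r ≤ ‖(2 * π) • η‖}

theorem measurableSet_highSet (n : ℕ) (r : ℝ) : MeasurableSet (highSet n r) :=
  measurableSet_le measurable_const (by fun_prop)

theorem norm_derivSymbol_sq (α : Fin n → ℕ) (ξ : Sp n) : ‖derivSymbol α ξ‖ ^ 2 = monoSq α ξ := by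
  rw [derivSymbol, norm_prod, ← Finset.prod_pow, monoSq]
  refine Finset.prod_congr rfl fun j _ => ?_
  rw [norm_pow, norm_mul, Complex.norm_I, one_mul, Complex.norm_real, ← pow_mul,
    mul_comm (α j), pow_mul, Real.norm_eq_abs, sq_abs]

/-- The normalized symbol `(iξ)^α / w_k(ξ)`. -/
def normSymbol (k : ℕ) (α : Fin n → ℕ) (ξ : Sp n) : ℂ := derivSymbol α ξ / weight k ξ

theorem normSymbol_zero (k : ℕ) (ξ : Sp n) :
    normSymbol k (fun i => ((MultiIndex.zero n k).1 i : ℕ)) ξ = (weight k ξ : ℂ)⁻¹ := by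
  simp [normSymbol, derivSymbol, MultiIndex.zero]

theorem continuous_normSymbol (k : ℕ) (α : Fin n → ℕ) :
    Continuous (normSymbol k α : Sp n → ℂ) := by
  unfold normSymbol derivSymbol
  have hw := continuous_weight (n := n) k
  exact Continuous.div (by fun_prop) (by fun_prop) (ofReal_weight_ne_zero k)

theorem norm_normSymbol_le_one {α : Fin n → ℕ} (hα : ∑ i, α i ≤ k) (ξ : Sp n) :
    ‖normSymbol k α ξ‖ ≤ 1 := by
  have hw := weight_pos k ξ
  rw [normSymbol, norm_div, Complex.norm_of_nonneg hw.le, div_le_one hw]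
  refine (sq_le_sq₀ (norm_nonneg _) hw.le).1 ?_
  rw [norm_derivSymbol_sq, weight_sq]
  exact monoSq_le_weightSq hα _

theorem sum_conj_normSymbol_mul (k : ℕ) (ξ : Sp n) :
    ∑ α : MultiIndex n k, (starRingEnd ℂ) (normSymbol k (fun i => (α.1 i : ℕ)) ξ) *
      derivSymbol (fun i => (α.1 i : ℕ)) ξ = weight k ξ := by
  have hterm (α : MultiIndex n k) : (starRingEnd ℂ) (normSymbol k (fun i => (α.1 i : ℕ)) ξ) *
      derivSymbol (fun i => (α.1 i : ℕ)) ξ =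
        (monoSq (fun i => (α.1 i : ℕ)) ξ / weight k ξ : ℝ) := by
    rw [normSymbol, map_div₀, Complex.conj_ofReal, div_mul_eq_mul_div, Complex.conj_mul',
      ← Complex.ofReal_pow, norm_derivSymbol_sq, Complex.ofReal_div]
  rw [Finset.sum_congr rfl fun α _ => hterm α, ← Complex.ofReal_sum, ← Finset.sum_div, ← weightSq,
    ← weight_sq, sq, mul_div_cancel_right₀ _ (weight_pos k ξ).ne']

theorem memLp_top_normSymbol (α : MultiIndex n k) :
    MemLp (fun η : Sp n => normSymbol k (fun i => (α.1 i : ℕ)) ((2 * π) • η)) ∞ volume :=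
  memLp_top_of_bound
    ((continuous_normSymbol k _).comp (continuous_const_smul _)).aestronglyMeasurable 1
    (Eventually.of_forall fun _ => norm_normSymbol_le_one α.2 _)

/-- The normalized symbol `(iξ)^α / w_k(ξ)` as a bounded function of `η = ξ / 2π`. -/
def normSymbolLp (k : ℕ) (α : MultiIndex n k) : Lp ℂ ∞ (volume : Measure (Sp n)) :=
  (memLp_top_normSymbol α).toLp _

theorem coeFn_normSymbolLp (α : MultiIndex n k) : normSymbolLp k α =ᵐ[volume] fun η =>
    normSymbol k (fun i => (α.1 i : ℕ)) ((2 * π) • η) :=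
  (memLp_top_normSymbol α).coeFn_toLp

/-- The function underlying an element of `H^k_(∞)`. -/
def toL2 (F : HHigh n k r) : L2 n := evalZero n k F

theorem fourier_coe_HHigh (F : HHigh n k r) (α : MultiIndex n k) :
    (𝓕 (F.1 α) : L2 n) =ᵐ[volume]
      fun η => derivSymbol (fun i => (α.1 i : ℕ)) ((2 * π) • η) * (𝓕 (toL2 F) : L2 n) η :=
  (((hasFourier_toDistr (toL2 F)).multiDeriv fun i => (α.1 i : ℕ)).toDistr_eq_iff _).1 (F.2.1 α)

theorem fourier_toL2_eq_zero (F : HHigh n k r) :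
    ∀ᵐ η : Sp n, η ∉ highSet n r → (𝓕 (toL2 F) : L2 n) η = 0 := by
  have hsupp : ∀ᵐ η : Sp n, ‖(2 * π) • η‖ < r → (𝓕 (toL2 F) : L2 n) η = 0 := F.2.2
  filter_upwards [hsupp] with η hη hmem
  exact hη (not_le.1 hmem)

theorem ext_fourier_toL2 {F G : HHigh n k r}
    (h : ∀ᵐ η ∂(volume.restrict (highSet n r)), (𝓕 (toL2 F) : L2 n) η = (𝓕 (toL2 G) : L2 n) η) :
    F = G := by
  have hfourier : (𝓕 (toL2 F) : L2 n) =ᵐ[volume] (𝓕 (toL2 G) : L2 n) := by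
    filter_upwards [(ae_restrict_iff' (measurableSet_highSet n r)).1 h, fourier_toL2_eq_zero F,
      fourier_toL2_eq_zero G] with η hη hF hG
    by_cases hmem : η ∈ highSet n r
    · exact hη hmem
    · rw [hF hmem, hG hmem]
  refine Subtype.ext (PiLp.ext fun α => (Lp.fourierTransformₗᵢ (Sp n) ℂ).injective (Lp.ext ?_))
  filter_upwards [hfourier, fourier_coe_HHigh F α, fourier_coe_HHigh G α] with η hη hF hG
  exact hF.trans (by rw [hη, hG.symm]; rfl)

/-- The weighted Fourier transform `F ↦ w_k F̂` on high frequencies. It is written in terms of the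
derivatives of `F`, as `∑_{|α| ≤ k} conj((iξ)^α / w_k) (∂^α F)^`, to make it bounded on `H^k`. -/
def weightedFourier (n k : ℕ) (r : ℝ) :
    HHigh n k r →L[ℂ] Lp ℂ 2 ((volume : Measure (Sp n)).restrict (highSet n r)) :=
  LpToLpRestrictCLM (Sp n) ℂ ℂ volume 2 (highSet n r) ∘L ∑ α : MultiIndex n k,
    linftyMul 2 (star (normSymbolLp k α)) ∘L
      (Lp.fourierTransformₗᵢ (Sp n) ℂ).toContinuousLinearEquiv.toContinuousLinearMap ∘L
      PiLp.proj 2 (fun _ : MultiIndex n k => L2 n) α ∘L (HHigh n k r).subtypeL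

theorem coeFn_weightedFourier (F : HHigh n k r) :
    weightedFourier n k r F =ᵐ[volume.restrict (highSet n r)]
      fun η => (weight k ((2 * π) • η) : ℂ) * (𝓕 (toL2 F) : L2 n) η := by
  have hsum : weightedFourier n k r F = LpToLpRestrictCLM (Sp n) ℂ ℂ volume 2 (highSet n r)
      (∑ α, linftyMul 2 (star (normSymbolLp k α)) (𝓕 (F.1 α))) := by
    rw [weightedFourier, ContinuousLinearMap.comp_apply, sum_apply]
    rfl
  have hterm : ∀ᵐ η : Sp n, ∀ α : MultiIndex n k,
      (linftyMul 2 (star (normSymbolLp k α)) (𝓕 (F.1 α)) : L2 n) η =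
        (starRingEnd ℂ) (normSymbol k (fun i => (α.1 i : ℕ)) ((2 * π) • η)) *
          (derivSymbol (fun i => (α.1 i : ℕ)) ((2 * π) • η) * (𝓕 (toL2 F) : L2 n) η) := by
    refine ae_all_iff.2 fun α => ?_
    filter_upwards [coeFn_linftyMul (star (normSymbolLp k α)) (𝓕 (F.1 α) : L2 n),
      Lp.coeFn_star (normSymbolLp k α), coeFn_normSymbolLp α, fourier_coe_HHigh F α]
      with η hmul hstar hsymb hF
    rw [hmul, hstar, Pi.star_apply, hsymb, hF]
    rfl
  rw [hsum]
  filter_upwards [LpToLpRestrictCLM_coeFn ℂ (highSet n r)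
      (∑ α, linftyMul 2 (star (normSymbolLp k α)) (𝓕 (F.1 α) : L2 n)),
    ae_restrict_of_ae (Lp.coeFn_fun_finsetSum Finset.univ fun α : MultiIndex n k =>
      linftyMul 2 (star (normSymbolLp k α)) (𝓕 (F.1 α) : L2 n)),
    ae_restrict_of_ae hterm] with η hrestrict hsum hterm
  rw [hrestrict, hsum, Finset.sum_congr rfl fun α _ => hterm α]
  simp only [← mul_assoc]
  rw [← Finset.sum_mul, sum_conj_normSymbol_mul]

/-- The family `(∂^α F)_{|α| ≤ k}` of the derivatives of the function `F` with `w_k F̂ = g`. -/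
def derivativesOfWeightedFourier (n k : ℕ) (r : ℝ) :
    Lp ℂ 2 ((volume : Measure (Sp n)).restrict (highSet n r)) →L[ℂ]
      PiLp 2 fun _ : MultiIndex n k => L2 n :=
  (PiLp.continuousLinearEquiv 2 ℂ fun _ : MultiIndex n k => L2 n).symm.toContinuousLinearMap ∘L
    ContinuousLinearMap.pi fun α : MultiIndex n k =>
      (Lp.fourierTransformₗᵢ (Sp n) ℂ).symm.toContinuousLinearEquiv.toContinuousLinearMap ∘L
      linftyMul 2 (normSymbolLp k α) ∘L
      (lpExtend ℂ volume 2 (measurableSet_highSet n r)).toContinuousLinearMap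

theorem fourier_derivativesOfWeightedFourier
    (g : Lp ℂ 2 ((volume : Measure (Sp n)).restrict (highSet n r))) (α : MultiIndex n k) :
    (𝓕 (derivativesOfWeightedFourier n k r g α) : L2 n) =ᵐ[volume] fun η =>
      normSymbol k (fun i => (α.1 i : ℕ)) ((2 * π) • η) * (highSet n r).indicator g η := by
  have hfourier : (𝓕 (derivativesOfWeightedFourier n k r g α) : L2 n) =
      linftyMul 2 (normSymbolLp k α) (lpExtend ℂ volume 2 (measurableSet_highSet n r) g) :=
    (Lp.fourierTransformₗᵢ (Sp n) ℂ).apply_symm_apply _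
  rw [hfourier]
  filter_upwards [coeFn_linftyMul (normSymbolLp k α)
      (lpExtend ℂ volume 2 (measurableSet_highSet n r) g), coeFn_normSymbolLp α,
    coeFn_lpExtend (𝕜 := ℂ) (measurableSet_highSet n r) g] with η hmul hsymb hext
  rw [hmul, hsymb, hext]

theorem derivativesOfWeightedFourier_mem
    (g : Lp ℂ 2 ((volume : Measure (Sp n)).restrict (highSet n r))) :
    derivativesOfWeightedFourier n k r g ∈ HHigh n k r := by
  have hzero := fourier_derivativesOfWeightedFourier g (MultiIndex.zero n k)
  refine ⟨fun α => ?_, ?_⟩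
  · refine (((hasFourier_toDistr _).multiDeriv fun i => (α.1 i : ℕ)).toDistr_eq_iff _).2 ?_
    filter_upwards [fourier_derivativesOfWeightedFourier g α, hzero] with η hα h₀
    rw [hα, h₀, normSymbol_zero, ← mul_assoc, ← div_eq_mul_inv, normSymbol]
  · change ∀ᵐ η : Sp n, ‖(2 * π) • η‖ < r →
      (𝓕 (derivativesOfWeightedFourier n k r g (MultiIndex.zero n k)) : L2 n) η = 0
    filter_upwards [hzero] with η h₀ hr
    rw [h₀, Set.indicator_of_notMem (fun hη : η ∈ highSet n r => hη.not_gt hr), mul_zero]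

/-- The inverse of the weighted Fourier transform. -/
def weightedFourierInv (n k : ℕ) (r : ℝ) :
    Lp ℂ 2 ((volume : Measure (Sp n)).restrict (highSet n r)) →L[ℂ] HHigh n k r :=
  (derivativesOfWeightedFourier n k r).codRestrict (HHigh n k r) derivativesOfWeightedFourier_mem

theorem fourier_toL2_weightedFourierInv
    (g : Lp ℂ 2 ((volume : Measure (Sp n)).restrict (highSet n r))) :
    ∀ᵐ η ∂(volume.restrict (highSet n r)), (𝓕 (toL2 (weightedFourierInv n k r g)) : L2 n) η =
      (weight k ((2 * π) • η) : ℂ)⁻¹ * g η := by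
  rw [ae_restrict_iff' (measurableSet_highSet n r)]
  filter_upwards [fourier_derivativesOfWeightedFourier g (MultiIndex.zero n k)] with η hη hmem
  rw [normSymbol_zero, Set.indicator_of_mem hmem] at hη
  exact hη

/-- The weighted Fourier transform identifies `H^k_(∞)` with `L²` on the high frequencies. -/
def weightedFourierEquiv (n k : ℕ) (r : ℝ) :
    HHigh n k r ≃L[ℂ] Lp ℂ 2 ((volume : Measure (Sp n)).restrict (highSet n r)) :=
  ContinuousLinearEquiv.equivOfInverse (weightedFourier n k r) (weightedFourierInv n k r)
    (fun F => by
      refine ext_fourier_toL2 ?_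
      filter_upwards [fourier_toL2_weightedFourierInv (weightedFourier n k r F),
        coeFn_weightedFourier F] with η hinv hF
      rw [hinv, hF, inv_mul_cancel_left₀ (ofReal_weight_ne_zero k _)])
    (fun g => by
      refine Lp.ext ?_
      filter_upwards [fourier_toL2_weightedFourierInv g,
        coeFn_weightedFourier (weightedFourierInv n k r g)] with η hinv hg
      rw [hg, hinv, mul_inv_cancel_left₀ (ofReal_weight_ne_zero k _)])

/-- The weighted Fourier transform of `u = (φ, m)`. -/
def stateEquiv (n k : ℕ) (r : ℝ) :
    X n (k + 1) r ≃L[ℂ] Lp (Val n) 2 ((volume : Measure (Sp n)).restrict (highSet n r)) :=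
  (WithLp.prodContinuousLinearEquiv 2 ℂ _ _).trans
    (((weightedFourierEquiv n (k + 1) r).prodCongr
      ((PiLp.continuousLinearEquiv 2 ℂ _).trans
        (ContinuousLinearEquiv.piCongrRight fun _ => weightedFourierEquiv n k r))).trans
    (lpProdPiEquiv ℂ ℂ ℂ (Fin n) _ 2))

/-- The Fourier transform `(φ̂, m̂)`, as a function of `η = ξ / 2π`. -/
def X.hat {s : ℕ} (u : X n s r) (η : Sp n) : Val n :=
  ((𝓕 u.phi : L2 n) η, fun j => (𝓕 (u.mom j) : L2 n) η)

theorem coeFn_stateEquiv (u : X n (k + 1) r) :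
    stateEquiv n k r u =ᵐ[volume.restrict (highSet n r)] fun η =>
      weightEquiv k ((2 * π) • η) (u.hat η) := by
  have hmom : ∀ᵐ η ∂(volume.restrict (highSet n r)), ∀ j,
      weightedFourier n k r (u.snd j) η =
        (weight k ((2 * π) • η) : ℂ) * (𝓕 (u.mom j) : L2 n) η :=
    ae_all_iff.2 fun j => coeFn_weightedFourier (u.snd j)
  filter_upwards [coeFn_lpOfComponents (𝕜 := ℂ) (weightedFourier n (k + 1) r u.fst,
    fun j => weightedFourier n k r (u.snd j)), coeFn_weightedFourier u.fst, hmom]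
    with η hcomp hφ hm
  exact hcomp.trans (Prod.ext hφ (funext hm))

end SobolevEquiv

section LinearizedSystem

variable {n s : ℕ} {r ν ν' κ : ℝ}

theorem isA_iff (u v : X n s r) :
    IsA ν ν' κ u v ↔ ∀ᵐ η : Sp n, v.hat η = -genSymbol ν ν' κ ((2 * π) • η) (u.hat η) := by
  have hφ := hasFourier_toDistr u.phi
  have hm (j : Fin n) := hasFourier_toDistr (u.mom j)
  have hdiv := hasFourier_divergence hm
  have hmom (j : Fin n) := (((hφ.laplacian.lineDeriv j).smul (κ : ℂ)).neg.sub
    ((hm j).laplacian.smul (ν : ℂ))).sub ((hdiv.lineDeriv j).smul (ν' : ℂ))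
  have hdot (η : Sp n) :
      ∑ j, Complex.I * (((2 * π) • η) j : ℝ) * (𝓕 (u.mom j) : L2 n) η =
        Complex.I * freqDot ((2 * π) • η) (u.hat η).2 := by
    rw [freqDot_apply, Finset.mul_sum]
    exact Finset.sum_congr rfl fun j _ => mul_assoc _ _ _
  rw [IsA, hdiv.toDistr_eq_iff, forall_congr' fun j => (hmom j).toDistr_eq_iff _]
  unfold EventuallyEq
  rw [← ae_all_iff, ← eventually_and]
  refine eventually_congr (Eventually.of_forall fun η => ?_)
  rw [genSymbol_apply, Prod.ext_iff, funext_iff]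
  refine and_congr (Eq.congr rfl ?_) (forall_congr' fun j => Eq.congr rfl ?_)
  · rw [Prod.fst_neg, neg_mul, neg_neg]
    exact hdot η
  · simp only [hdot, X.hat, Prod.snd_neg, Pi.neg_apply]
    linear_combination (-(ν' : ℂ) * (((2 * π) • η) j : ℝ) *
      freqDot ((2 * π) • η) fun i => (𝓕 (u.mom i) : L2 n) η) * Complex.I_sq

theorem isSolutionAt_iff (t : ℝ) (u v : X n s r) :
    IsSolutionAt ν ν' κ t u v ↔
      ∀ᵐ η : Sp n, v.hat η = solVec ν ν' κ ((2 * π) • η) (u.hat η) t := by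
  rw [IsSolutionAt, ← ae_all_iff, ← eventually_and]
  refine eventually_congr (Eventually.of_forall fun η => ?_)
  rw [Prod.ext_iff, funext_iff]
  rfl

theorem hat_eq_zero (u : X n s r) : ∀ᵐ η : Sp n, η ∉ highSet n r → u.hat η = 0 := by
  filter_upwards [fourier_toL2_eq_zero u.fst,
    ae_all_iff.2 fun j => fourier_toL2_eq_zero (u.snd j)] with η hφ hm hη
  exact Prod.ext (hφ hη) (funext fun j => hm j hη)

theorem hat_neg (u : X n s r) : (-u).hat =ᵐ[volume] -u.hat := by
  have hfourier (f : L2 n) : (𝓕 (-f) : L2 n) =ᵐ[volume] -(𝓕 f : L2 n) := by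
    rw [show (𝓕 (-f) : L2 n) = -𝓕 f from map_neg (Lp.fourierTransformₗᵢ (Sp n) ℂ) f]
    exact Lp.coeFn_neg _
  filter_upwards [hfourier u.phi, ae_all_iff.2 fun j => hfourier (u.mom j)] with η hφ hm
  exact Prod.ext hφ (funext hm)

theorem ae_restrict_hat_eq_iff (u v : X n s r) {G : Sp n → Val n → Val n} (hG : ∀ η, G η 0 = 0) :
    (∀ᵐ η ∂(volume.restrict (highSet n r)), v.hat η = G η (u.hat η)) ↔
      ∀ᵐ η : Sp n, v.hat η = G η (u.hat η) := by
  refine ⟨fun h => ?_, ae_restrict_of_ae⟩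
  filter_upwards [(ae_restrict_iff' (measurableSet_highSet n r)).1 h, hat_eq_zero u,
    hat_eq_zero v] with η hη hu hv
  by_cases hmem : η ∈ highSet n r
  · exact hη hmem
  · rw [hu hmem, hv hmem, hG]

theorem solVec_zero_right (ξ : Sp n) (t : ℝ) : solVec ν ν' κ ξ 0 t = 0 := by
  ext <;> simp [solVec]

end LinearizedSystem

section SolutionOperator

variable {n k : ℕ} {r ν ν' κ : ℝ}

theorem exists_isStableSymbol (n k : ℕ) (hν : 0 ≤ ν) (hνν' : 0 < ν + ν') (hκ : 0 ≤ κ)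
    (hr : 0 < r) :
    ∃ C : ℝ, IsStableSymbol (fun η : Sp n => weightedSymbol ν ν' κ k ((2 * π) • η))
      (volume.restrict (highSet n r)) C := by
  obtain ⟨C, hC⟩ := exists_norm_exp_weightedSymbol_le n k hν hνν' hκ hr
  refine ⟨C, ((continuous_weightedSymbol k).comp
    (continuous_const_smul (2 * π))).aestronglyMeasurable, ?_⟩
  filter_upwards [ae_restrict_mem (measurableSet_highSet n r)] with η hη
  exact hC _ hη

variable {C : ℝ} (hb : IsStableSymbol (fun η : Sp n => weightedSymbol ν ν' κ k ((2 * π) • η))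
  (volume.restrict (highSet n r)) C)

/-- The solution semigroup `S_∞(t)` of the linearized Navier–Stokes–Korteweg system, defined as
multiplication by the exponential of the symbol on the weighted Fourier side. -/
def solutionOp (t : ℝ≥0) : X n (k + 1) r →L[ℂ] X n (k + 1) r :=
  conjFamily (stateEquiv n k r) (mulSemigroup 2 hb) t

theorem stateEquiv_solutionOp (t : ℝ≥0) (u : X n (k + 1) r) :
    stateEquiv n k r (solutionOp hb t u) = mulSemigroup 2 hb t (stateEquiv n k r u) :=
  apply_conjFamily _ t u

theorem isSolutionAt_solutionOp (hνν' : ν + ν' ≠ 0) (hκ : 0 ≤ κ) (hr : 0 < r) (t : ℝ≥0)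
    (u : X n (k + 1) r) : IsSolutionAt ν ν' κ t u (solutionOp hb t u) := by
  rw [isSolutionAt_iff, ← ae_restrict_hat_eq_iff u (solutionOp hb t u)
    (G := fun η v => solVec ν ν' κ ((2 * π) • η) v t) fun η => solVec_zero_right _ _]
  have hS := coeFn_stateEquiv (solutionOp hb t u)
  rw [stateEquiv_solutionOp] at hS
  filter_upwards [hS, coeFn_mulSemigroup hb t (stateEquiv n k r u), coeFn_stateEquiv u,
    ae_restrict_mem (measurableSet_highSet n r)] with η hSη hexp hu hη
  have hξ : (2 * π) • η ≠ 0 := norm_pos_iff.1 (hr.trans_le hη)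
  refine (weightEquiv k ((2 * π) • η)).injective ?_
  rw [← hSη, hexp, hu, exp_weightedSymbol_weightEquiv hνν' hκ k hξ]

theorem isGeneratorAt_solutionOp_iff (u w : X n (k + 1) r) :
    IsGeneratorAt (solutionOp hb) u w ↔ IsA ν ν' κ u (-w) := by
  have hneg : (∀ᵐ η : Sp n, (-w).hat η = -genSymbol ν ν' κ ((2 * π) • η) (u.hat η)) ↔
      ∀ᵐ η : Sp n, w.hat η = genSymbol ν ν' κ ((2 * π) • η) (u.hat η) := by
    refine eventually_congr ?_
    filter_upwards [hat_neg w] with η hη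
    rw [hη, Pi.neg_apply, neg_inj]
  rw [isA_iff, hneg, ← ae_restrict_hat_eq_iff u w
    (G := fun η v => genSymbol ν ν' κ ((2 * π) • η) v) fun η => map_zero _]
  refine (isGeneratorAt_conjFamily_iff (stateEquiv n k r) u w).trans ?_
  rw [isGeneratorAt_mulSemigroup_iff (p := 2) hb ENNReal.ofNat_ne_top]
  refine eventually_congr ?_
  filter_upwards [coeFn_stateEquiv u, coeFn_stateEquiv w] with η hu hw
  rw [hu, hw, weightedSymbol_weightEquiv, (weightEquiv k ((2 * π) • η)).injective.eq_iff]

theorem continuous_solutionOp_apply (u : X n (k + 1) r) : Continuous fun t => solutionOp hb t u :=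
  (stateEquiv n k r).symm.continuous.comp
    (continuous_mulSemigroup_apply hb ENNReal.ofNat_ne_top (stateEquiv n k r u))

end SolutionOperator

end NSK

end

theorem proposition4p3_general (n s : ℕ) (hs : 1 ≤ s) (ν ν' κ r : ℝ) (hν : 0 ≤ ν)
    (hνν' : 0 < ν + ν') (hκ : 0 ≤ κ) (hr : 0 < r) :
    ∃ S : ℝ≥0 → NSK.X n s r →L[ℂ] NSK.X n s r,
      (∀ (t : ℝ≥0) (u : NSK.X n s r), NSK.IsSolutionAt ν ν' κ t u (S t u)) ∧
      NSK.IsC0Semigroup S ∧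
      (∀ u w : NSK.X n s r, NSK.IsGeneratorAt S u w ↔ NSK.IsA ν ν' κ u (-w)) ∧
      (∀ T : ℝ≥0, 0 < T → ∀ u₀ : ℝ≥0 → NSK.X n s r, ContinuousOn u₀ (Set.Icc 0 T) →
        ContinuousOn (fun t => S t (u₀ t)) (Set.Icc 0 T)) ∧
      ∃ C : ℝ, 0 < C ∧ ∀ (t : ℝ≥0) (u₀ : NSK.X n s r), ‖S t u₀‖ ≤ C * ‖u₀‖ := by
  obtain ⟨k, rfl⟩ : ∃ k, s = k + 1 := Nat.exists_eq_succ_of_ne_zero (by omega)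
  obtain ⟨_, hb⟩ := NSK.exists_isStableSymbol n k hν hνν' hκ hr
  obtain ⟨C, hC₀, hC⟩ := NSK.exists_norm_conjFamily_le (NSK.stateEquiv n k r)
    (NSK.norm_mulSemigroup_le (p := 2) hb)
  exact ⟨NSK.solutionOp hb, NSK.isSolutionAt_solutionOp hb hνν'.ne' hκ hr,
    NSK.isC0Semigroup_conjFamily _ (NSK.isC0Semigroup_mulSemigroup hb ENNReal.ofNat_ne_top),
    NSK.isGeneratorAt_solutionOp_iff hb,
    fun _ _ _ hu₀ => NSK.continuousOn_clm_apply_of_norm_le hC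
      (NSK.continuous_solutionOp_apply hb) hu₀,
    C, hC₀, hC⟩

theorem proposition4p3 (n s : ℕ) (hn : 3 ≤ n) (hs : n / 2 + 1 ≤ s)
    (μ μ' κ r₁ : ℝ) (hμ : 0 < μ) (hμ' : 0 ≤ 2 / n * μ + μ') (hκ : 0 < κ) (hr₁ : 0 < r₁) :
    ∃ S : ℝ≥0 → NSK.X n s r₁ →L[ℂ] NSK.X n s r₁,
      -- `S` is the solution operator given by the explicit Fourier multiplier
      (∀ (t : ℝ≥0) (u : NSK.X n s r₁), NSK.IsSolutionAt μ (μ + μ') κ t u (S t u)) ∧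
      NSK.IsC0Semigroup S ∧
      -- the infinitesimal generator of `S` is `-A`
      (∀ u w : NSK.X n s r₁, NSK.IsGeneratorAt S u w ↔ NSK.IsA μ (μ + μ') κ u (-w)) ∧
      (∀ T : ℝ≥0, 0 < T → ∀ u₀ : ℝ≥0 → NSK.X n s r₁, ContinuousOn u₀ (Set.Icc 0 T) →
        ContinuousOn (fun t => S t (u₀ t)) (Set.Icc 0 T)) ∧
      ∃ C : ℝ, 0 < C ∧ ∀ (t : ℝ≥0) (u₀ : NSK.X n s r₁), ‖S t u₀‖ ≤ C * ‖u₀‖ := by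
  have hn_inv : 2 / (n : ℝ) < 2 := div_lt_self two_pos (by exact_mod_cast (by omega : 1 < n))
  exact proposition4p3_general n s (by omega) μ (μ + μ') κ r₁ hμ.le (by nlinarith) hκ.le hr₁
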